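/- For an integer $q\ge 3$ let $Prime(q)$ be the simplicial complex whose faces are the nonempty finite sets $\{p_0,\dots,p_n\}$ of distinct primes with $p_0+\dots+p_n<q$; topological statements about $Prime(q)$ refer to its geometric realization. A bouquet of spheres is a wedge of spheres of possibly different dimensions; $0$-spheres are allowed, and the empty bouquet is a point. Let $q\ge 4$ be an even integer. Then $[q-2,q)\cap\mathbb{Z}=\{O,E\}$, where $O=q-1$ is the unique odd and $E=q-2$ the unique even integer in the interval $[q-2,q)$, and the following hold. 1. $Prime(q)$ has the homotopy type of a (finite) bouquet of spheres, with exactly one $j$-sphere for every way (disregarding order) of writing an element of $\{O,E\}$ as a sum of $j+1$ distinct odd primes, $j\ge 0$. 2. For every $j\ge 0$, the dimension of the reduced homology $\bar H_j(Prime(q);\mathbb{Q})$ is equal to the number of ways of writing an element of $\{O,E\}$ as a sum of $j+1$ distinct odd primes. 3. If $q\ge 6$, then $Prime(q)$ is not connected if and only if $O=q-1$ is a prime number. 4. If $q\ge 6$, then $Prime(q)$ has a connected component that is not simply connected if and only if $E=q-2$ is a sum of two distinct odd primes. Consequently: 5. The Twin Prime Conjecture (there are infinitely many primes $p$ such that $p+2$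 is prime) is equivalent to the statement that $Prime(q)$ and $Prime(q+2)$ are both disconnected for infinitely many even $q\ge 4$. 6. The Goldbach Conjecture (every even integer $n\ge 4$ is a sum of two primes) is equivalent to the statement that $Prime(q)$ has a non-simply-connected component for every even $q\ge 6$ such that $q-2$ is not twice a prime. -/

import Mathlib

open scoped ContinuousMap

/-- The scalar quota complex with weight function `w` and quota `q`: the simplicial complex whose
faces are the nonempty finite sets of vertices of total weight less than `q`. -/
def quotaComplex {V : Type*} (w : V → ℝ) (hw : ∀ v, 0 < w v) (q : ℝ) :
    PreAbstractSimplicialComplex V where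
  faces := {F | F.Nonempty ∧ ∑ v ∈ F, w v < q}
  isRelLowerSet_faces := fun _ hF =>
    ⟨hF.1, fun _ hGF hG =>
      ⟨hG, (Finset.sum_le_sum_of_subset_of_nonneg hGF fun v _ _ => (hw v).le).trans_lt hF.2⟩⟩

/-- The complex `Prime(q)`: the quota complex on the set of all primes, the prime `p` having
weight `p`, with quota `q`. -/
def primeComplex (q : ℕ) : PreAbstractSimplicialComplex {p : ℕ // p.Prime} :=
  quotaComplex (fun p => ((p : ℕ) : ℝ)) (fun p => Nat.cast_pos.2 p.2.pos) (q : ℝ)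

/-- `Prime(q)` is a finite simplicial complex. -/
theorem primeComplex_faces_finite (q : ℕ) : (primeComplex q).faces.Finite := by
  have hs : {p : {p : ℕ // p.Prime} | (p : ℕ) < q}.Finite :=
    (Set.finite_lt_nat q).preimage Subtype.val_injective.injOn
  refine hs.toFinset.powerset.finite_toSet.subset fun F hF => ?_
  simp only [Finset.coe_powerset, Set.mem_preimage, Set.mem_powerset_iff, Set.Finite.coe_toFinset]
  intro p hp
  have h : ((p : ℕ) : ℝ) < q := (Finset.single_le_sum
    (f := fun v : {p : ℕ // p.Prime} => ((v : ℕ) : ℝ)) (fun v _ => Nat.cast_nonneg _) hp).trans_lt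
    hF.2
  exact Nat.cast_lt.1 h

/-- The geometric realization of a simplicial complex in barycentric coordinates: the points of
`V → ℝ` with nonnegative coordinates, which vanish outside some face and add up to `1`.
For a finite complex the topology induced by the product topology of `V → ℝ` is the usual
topology of the realization. -/
def geometricRealization {V : Type*} (K : PreAbstractSimplicialComplex V) : Set (V → ℝ) :=
  {x | ∃ F ∈ K.faces, (∀ v, 0 ≤ x v) ∧ (∀ v, v ∉ F → x v = 0) ∧ ∑ v ∈ F, x v = 1}

/-- The unit sphere `S^n` in `ℝ^(n+1)`. -/
abbrev UnitSphere (n : ℕ) : Type :=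
  Metric.sphere (0 : EuclideanSpace ℝ (Fin (n + 1))) 1

/-- The base point `(1, 0, …, 0)` of `S^n`. -/
noncomputable def UnitSphere.base (n : ℕ) : UnitSphere n :=
  ⟨EuclideanSpace.single 0 1, by simp⟩

/-- The relation on the disjoint union of a point and spheres that identifies the base point of
every sphere with the extra point. -/
inductive BouquetRel {ι : Type*} (d : ι → ℕ) :
    Unit ⊕ (Σ i, UnitSphere (d i)) → Unit ⊕ (Σ i, UnitSphere (d i)) → Prop
  | glue (i : ι) : BouquetRel d (Sum.inl ()) (Sum.inr ⟨i, UnitSphere.base (d i)⟩)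

/-- The bouquet (wedge) of spheres with one sphere of dimension `d i` for every `i : ι`;
it carries the quotient topology. Spheres of dimension `0` are allowed and the empty bouquet is
a point. -/
abbrev Bouquet {ι : Type*} (d : ι → ℕ) : Type _ :=
  Quot (BouquetRel d)

/-- The ways of writing `n` as a sum of `m` distinct odd primes. -/
def oddPrimeSums (n m : ℕ) : Set (Finset ℕ) :=
  {F | F.card = m ∧ (∀ p ∈ F, p.Prime ∧ Odd p) ∧ ∑ p ∈ F, p = n}

section Homology

variable {V : Type*} [LinearOrder V]

/-- The simplicial boundary map over `ℚ`, all finite sets of vertices being oriented by the order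
of the vertices:
`∂ [v₀ < ⋯ < vₙ] = ∑ i, (-1) ^ i • [v₀, …, v̂ᵢ, …, vₙ]`. A vertex has boundary `[∅]`,
so this is the boundary map of the augmented complex. -/
noncomputable def simplicialBoundary : (Finset V →₀ ℚ) →ₗ[ℚ] (Finset V →₀ ℚ) :=
  Finsupp.linearCombination ℚ fun F : Finset V =>
    ∑ v ∈ F, (-1 : ℚ) ^ (F.filter (· < v)).card • Finsupp.single (F.erase v) (1 : ℚ)

/-- The rational simplicial `n`-chains of `K`, spanned by the faces with `n + 1` vertices. -/
def simplicialChains (K : PreAbstractSimplicialComplex V) (n : ℕ) : Submodule ℚ (Finset V →₀ ℚ) :=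
  Finsupp.supported ℚ ℚ {F | F ∈ K.faces ∧ F.card = n + 1}

/-- The reduced `n`-cycles of `K`: the chains of boundary zero (for `n = 0`: of coefficient sum
zero). -/
noncomputable def reducedCycles (K : PreAbstractSimplicialComplex V) (n : ℕ) :
    Submodule ℚ (Finset V →₀ ℚ) :=
  simplicialChains K n ⊓ LinearMap.ker simplicialBoundary

/-- The `n`-boundaries of `K`. -/
noncomputable def simplicialBoundaries (K : PreAbstractSimplicialComplex V) (n : ℕ) :
    Submodule ℚ (Finset V →₀ ℚ) :=
  (simplicialChains K (n + 1)).map simplicialBoundary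

theorem simplicialBoundary_simplicialBoundary (x : Finset V →₀ ℚ) :
    simplicialBoundary (simplicialBoundary x) = 0 := by
  suffices h : (simplicialBoundary (V := V)) ∘ₗ simplicialBoundary = 0 from
    LinearMap.congr_fun h x
  refine Finsupp.lhom_ext' fun F => LinearMap.ext_ring ?_
  simp only [simplicialBoundary, LinearMap.comp_apply, Finsupp.lsingle_apply,
    Finsupp.linearCombination_single, one_smul, map_sum, map_smul, LinearMap.zero_apply]
  simp only [Finset.smul_sum, smul_smul]
  rw [Finset.sum_sigma']
  have key : ∀ u v : V, v ∈ F → u ∈ F → u < v →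
      (-1 : ℚ) ^ (F.filter (· < v)).card * (-1) ^ ((F.erase v).filter (· < u)).card +
        (-1) ^ (F.filter (· < u)).card * (-1) ^ ((F.erase u).filter (· < v)).card = 0 := by
    intro u v hv hu h
    have h1 : (F.erase v).filter (· < u) = F.filter (· < u) := by
      ext a; simp only [Finset.mem_filter, Finset.mem_erase]
      exact ⟨fun k => ⟨k.1.2, k.2⟩, fun k => ⟨⟨(k.2.trans h).ne, k.1⟩, k.2⟩⟩
    have h2 : (F.erase u).filter (· < v) = (F.filter (· < v)).erase u := by
      ext a; simp only [Finset.mem_filter, Finset.mem_erase]; tauto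
    have h3 : ((F.filter (· < v)).erase u).card + 1 = (F.filter (· < v)).card :=
      Finset.card_erase_add_one (Finset.mem_filter.2 ⟨hu, h⟩)
    rw [h1, h2, ← h3, pow_succ]
    ring
  refine Finset.sum_involution (fun a _ => ⟨a.2, a.1⟩) ?_ ?_ ?_ ?_
  · rintro ⟨v, u⟩ ha
    simp only [Finset.mem_sigma, Finset.mem_erase] at ha
    obtain ⟨hv, huv, hu⟩ := ha
    simp only [Finset.erase_right_comm (a := u) (b := v), ← add_smul]
    rcases lt_or_gt_of_ne huv with h | h
    · rw [key u v hv hu h, zero_smul]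
    · rw [add_comm, key v u hu hv h, zero_smul]
  · rintro ⟨v, u⟩ ha _ h
    simp only [Finset.mem_sigma, Finset.mem_erase] at ha
    exact ha.2.1 (Sigma.mk.inj_iff.1 h).1
  · rintro ⟨v, u⟩ ha
    simp only [Finset.mem_sigma, Finset.mem_erase] at ha ⊢
    exact ⟨ha.2.2, ha.2.1.symm, ha.1⟩
  · rintro ⟨v, u⟩ ha
    rfl

theorem simplicialBoundaries_le_reducedCycles (K : PreAbstractSimplicialComplex V) (n : ℕ) :
    simplicialBoundaries K n ≤ reducedCycles K n := by
  rintro _ ⟨x, hx, rfl⟩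
  refine ⟨?_, simplicialBoundary_simplicialBoundary x⟩
  rw [SetLike.mem_coe, simplicialBoundary, Finsupp.linearCombination_apply, Finsupp.sum]
  refine Submodule.sum_mem _ fun F hF => Submodule.smul_mem _ _ (Submodule.sum_mem _ fun v hv =>
    Submodule.smul_mem _ _ (Finsupp.single_mem_supported _ _ ?_))
  have hF' : F ∈ K.faces ∧ F.card = n + 1 + 1 := hx hF
  have hc := Finset.card_erase_add_one hv
  refine ⟨(K.isRelLowerSet_faces hF'.1).2 (Finset.erase_subset _ _)
    (Finset.card_pos.1 (by omega)), by omega⟩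

/-- The reduced simplicial homology of a (nonempty) complex `K` with rational coefficients. -/
abbrev ReducedHomology (K : PreAbstractSimplicialComplex V) (n : ℕ) : Type _ :=
  reducedCycles K n ⧸ (simplicialBoundaries K n).submoduleOf (reducedCycles K n)

end Homology

/-- The space `X` has a connected component that is not simply connected. -/
def HasNonSimplyConnectedComponent (X : Type*) [TopologicalSpace X] : Prop :=
  ∃ x : X, ¬ IsSimplyConnected (connectedComponent x)

/-- The twin prime conjecture. -/
def TwinPrimeConjecture : Prop :=
  {p : ℕ | p.Prime ∧ (p + 2).Prime}.Infinite

/-- The Goldbach conjecture. -/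
def GoldbachConjecture : Prop :=
  ∀ n : ℕ, 4 ≤ n → Even n → ∃ p r : ℕ, p.Prime ∧ r.Prime ∧ n = p + r

/-!
The idea is that `Prime(q)` is a cone with apex `2`, up to finitely many simplices attached along
their boundaries. A set `F` of odd primes is a face but does not lie in the cone if and only if its
sum is less than `q` while adding `2` leads to at least `q`, that is, if the sum is `q - 1` or
`q - 2`. Every odd prime is at least `3`, so that replacing an element of such a set by `2` decreases
the sum; hence the boundary of `F` does lie in the cone. This property of a simplicial complex is
called `IsAlmostCone`, and the faces outside the cone are its `coneCells`. For `Prime(q)` it is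
shown in `isAlmostCone_primeComplex`, and `exists_equiv_coneCells` identifies the cells with sums
of distinct odd primes. The rest holds for every finite almost cone.

*Homology.* The cone operator `F ↦ insert a F` is a contracting homotopy on the chains of the full
simplex. It shows that a cycle is a boundary exactly if its coefficients at all cells vanish, and
that these coefficients are arbitrary (`rank_reducedHomology_of_isAlmostCone`).

*Homotopy type.* Collapsing the cone to a point turns every cell into a sphere; the collapse map
`collapseCone` to the bouquet is given by explicit formulas in barycentric coordinates. It is
a homotopy equivalence because the contraction of the cone extends to a deformation of the whole
realization (`coneDeformation`), which descends to the bouquet by compactness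
(`nonempty_homotopyEquiv_of_collapse`).

*Connectedness.* Cells of cardinality `1` are isolated points, while all other cells are joined to
the cone (`IsAlmostCone.connectedSpace_iff`).

*Simple connectedness.* What remains after removing the isolated points is `mainPart`. An edge
outside the cone gives a loop in it that is detected by a map to the circle
(`IsAlmostCone.not_isSimplyConnected_mainPart`). If all cells have dimension at least two, then the
complement of their barycentres is contractible, and it meets every open cell in a path connected
set, so that a simple case of van Kampen's theorem applies
(`IsAlmostCone.isSimplyConnected_mainPart`).

The statements about twin primes and Goldbach's conjecture then amount to elementary arithmetic.
-/

/-! ### Complexes that are almost cones, and their homology -/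

/-- The complex `K` is a cone with apex `a`, up to additional faces (the faces `F` for which
`insert a F` is not a face) whose whole boundary lies in the cone. -/
structure IsAlmostCone {V : Type*} [DecidableEq V] (K : PreAbstractSimplicialComplex V) (a : V) :
    Prop where
  apex_mem : {a} ∈ K.faces
  insert_erase_mem : ∀ F ∈ K.faces, insert a F ∉ K.faces → ∀ v ∈ F, insert a (F.erase v) ∈ K.faces

/-- The faces of `K` which do not lie in the cone with apex `a`. -/
def coneCells {V : Type*} [DecidableEq V] (K : PreAbstractSimplicialComplex V) (a : V) :
    Set (Finset V) :=
  {F | F ∈ K.faces ∧ insert a F ∉ K.faces}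

theorem face_of_subset {V : Type*} {K : PreAbstractSimplicialComplex V} {F G : Finset V}
    (hF : F ∈ K.faces) (hGF : G ⊆ F) (hG : G.Nonempty) :
    G ∈ K.faces :=
  (K.isRelLowerSet_faces hF).2 hGF hG

theorem face_nonempty {V : Type*} {K : PreAbstractSimplicialComplex V} {F : Finset V}
    (hF : F ∈ K.faces) : F.Nonempty :=
  (K.isRelLowerSet_faces hF).1

section Cells

variable {V : Type*} [DecidableEq V] {K : PreAbstractSimplicialComplex V} {a : V}

theorem apex_notMem_of_mem_coneCells {F : Finset V} (hF : F ∈ coneCells K a) : a ∉ F :=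
  fun h => hF.2 (by rw [Finset.insert_eq_self.2 h]; exact hF.1)

/-- The faces outside the cone are maximal: if `G` contains `F` and one more vertex `v`, then
`insert a F` is contained in `insert a (G.erase v)`. -/
theorem IsAlmostCone.eq_of_subset (hK : IsAlmostCone K a) {F G : Finset V}
    (hF : F ∈ coneCells K a) (hG : G ∈ K.faces) (hFG : F ⊆ G) : G = F := by
  by_contra hne
  obtain ⟨v, hvG, hvF⟩ : ∃ v ∈ G, v ∉ F := by
    by_contra! h
    exact hne (Finset.Subset.antisymm h hFG)
  have hGc : insert a G ∉ K.faces := fun h =>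
    hF.2 (face_of_subset h (Finset.insert_subset_insert a hFG) (Finset.insert_nonempty _ _))
  refine hF.2 (face_of_subset (hK.insert_erase_mem G hG hGc v hvG)
    (Finset.insert_subset_insert a fun u hu => ?_) (Finset.insert_nonempty _ _))
  exact Finset.mem_erase.2 ⟨fun h => hvF (h ▸ hu), hFG hu⟩

end Cells

section HomologyOfAlmostCone

variable {V : Type*} [LinearOrder V]

/-- The cone operator with apex `a`, which sends `F` to `insert a F` if `a ∉ F` and to `0`
otherwise. No sign is needed when `a` is the least vertex. -/
noncomputable def coneOperator (a : V) : (Finset V →₀ ℚ) →ₗ[ℚ] (Finset V →₀ ℚ) :=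
  Finsupp.linearCombination ℚ fun F : Finset V =>
    if a ∈ F then 0 else Finsupp.single (insert a F) (1 : ℚ)

theorem coneOperator_single_of_mem {a : V} {F : Finset V} (h : a ∈ F) (r : ℚ) :
    coneOperator a (Finsupp.single F r) = 0 := by
  simp [coneOperator, h]

theorem coneOperator_single_of_notMem {a : V} {F : Finset V} (h : a ∉ F) (r : ℚ) :
    coneOperator a (Finsupp.single F r) = Finsupp.single (insert a F) r := by
  simp [coneOperator, h]

theorem simplicialBoundary_single (F : Finset V) (r : ℚ) :
    simplicialBoundary (Finsupp.single F r) =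
      r • ∑ v ∈ F, (-1 : ℚ) ^ (F.filter (· < v)).card • Finsupp.single (F.erase v) (1 : ℚ) := by
  simp [simplicialBoundary]

/-- The cone operator is a contracting homotopy of the augmented complex of all finite sets. -/
theorem boundary_coneOperator_add {a : V} (ha : ∀ v, a ≤ v) (x : Finset V →₀ ℚ) :
    simplicialBoundary (coneOperator a x) + coneOperator a (simplicialBoundary x) = x := by
  suffices h : simplicialBoundary ∘ₗ coneOperator a + coneOperator a ∘ₗ simplicialBoundary =
      LinearMap.id from LinearMap.congr_fun h x
  refine Finsupp.lhom_ext' fun F => LinearMap.ext_ring ?_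
  simp only [LinearMap.add_apply, LinearMap.comp_apply, Finsupp.lsingle_apply, LinearMap.id_apply]
  by_cases haF : a ∈ F
  · rw [coneOperator_single_of_mem haF, map_zero, zero_add, simplicialBoundary_single, one_smul,
      map_sum, Finset.sum_eq_single_of_mem a haF]
    · rw [map_smul, coneOperator_single_of_notMem (Finset.notMem_erase a F),
        Finset.insert_erase haF, Finset.filter_false_of_mem fun v _ => not_lt.2 (ha v)]
      simp
    · intro v _ hva
      rw [map_smul, coneOperator_single_of_mem (Finset.mem_erase.2 ⟨hva.symm, haF⟩), smul_zero]
  · rw [coneOperator_single_of_notMem haF, simplicialBoundary_single, simplicialBoundary_single,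
      one_smul, one_smul, Finset.sum_insert haF, Finset.erase_insert haF,
      Finset.filter_false_of_mem fun v _ => not_lt.2 (ha v), map_sum, add_assoc,
      ← Finset.sum_add_distrib, Finset.sum_eq_zero]
    · simp
    · intro v hv
      have hav : a < v := lt_of_le_of_ne (ha v) fun h => haF (h ▸ hv)
      rw [map_smul, coneOperator_single_of_notMem fun h => haF (Finset.mem_of_mem_erase h),
        Finset.erase_insert_of_ne hav.ne, Finset.filter_insert, if_pos hav,
        Finset.card_insert_of_notMem (by simp [haF]), pow_succ, mul_neg_one, neg_smul,
        neg_add_cancel]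

variable {K : PreAbstractSimplicialComplex V} {a : V}

/-- The restriction of a cycle to the faces outside the cone. -/
noncomputable def restrictToCells (K : PreAbstractSimplicialComplex V) (a : V) (n : ℕ) :
    reducedCycles K n →ₗ[ℚ] ({F | F ∈ coneCells K a ∧ F.card = n + 1} →₀ ℚ) :=
  (Finsupp.lsubtypeDomain {F | F ∈ coneCells K a ∧ F.card = n + 1}) ∘ₗ (reducedCycles K n).subtype

theorem ker_restrictToCells (ha : ∀ v, a ≤ v) (hK : IsAlmostCone K a) (n : ℕ) :
    LinearMap.ker (restrictToCells K a n) =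
      (simplicialBoundaries K n).submoduleOf (reducedCycles K n) := by
  ext ⟨z, hz⟩
  change _ ↔ z ∈ simplicialBoundaries K n
  rw [LinearMap.mem_ker, Finsupp.ext_iff]
  simp only [restrictToCells, LinearMap.comp_apply, Submodule.subtype_apply,
    Finsupp.lsubtypeDomain_apply, Finsupp.subtypeDomain_apply, Finsupp.zero_apply]
  constructor
  · intro h
    refine ⟨coneOperator a z, ?_, ?_⟩
    · rw [SetLike.mem_coe, coneOperator, Finsupp.linearCombination_apply, Finsupp.sum]
      refine Submodule.sum_mem _ fun F hF => Submodule.smul_mem _ _ ?_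
      have hF' : F ∈ K.faces ∧ F.card = n + 1 := hz.1 hF
      split_ifs with haF
      · exact Submodule.zero_mem _
      · refine Finsupp.single_mem_supported _ _ ⟨?_, ?_⟩
        · by_contra hc
          exact Finsupp.mem_support_iff.1 hF (h ⟨F, ⟨hF'.1, hc⟩, hF'.2⟩)
        · rw [Finset.card_insert_of_notMem haF, hF'.2]
    · have := boundary_coneOperator_add ha z
      rwa [LinearMap.mem_ker.1 hz.2, map_zero, add_zero] at this
  · rintro ⟨y, hy, hyz⟩ ⟨F, hF, hcard⟩
    have hyz : simplicialBoundary y = z := hyz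
    change z F = 0
    rw [← hyz, simplicialBoundary, Finsupp.linearCombination_apply, Finsupp.sum,
      Finsupp.finsetSum_apply]
    refine Finset.sum_eq_zero fun G hG => ?_
    have hG' : G ∈ K.faces ∧ G.card = n + 1 + 1 := hy hG
    rw [Finsupp.smul_apply, Finsupp.finsetSum_apply, Finset.sum_eq_zero, smul_zero]
    intro v hv
    rw [Finsupp.smul_apply, Finsupp.single_apply, if_neg, smul_zero]
    intro h
    have := hK.eq_of_subset hF hG'.1 (h ▸ Finset.erase_subset v G)
    rw [this] at hG'
    omega

theorem restrictToCells_surjective (ha : ∀ v, a ≤ v) (hK : IsAlmostCone K a) (n : ℕ) :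
    Function.Surjective (restrictToCells K a n) := by
  rw [← LinearMap.range_eq_top, eq_top_iff]
  rintro f -
  induction f using Finsupp.induction_linear with
  | zero => exact Submodule.zero_mem _
  | add f g hf hg => exact Submodule.add_mem _ hf hg
  | single F r =>
    obtain ⟨F, hF, hcard⟩ := F
    have haF := apex_notMem_of_mem_coneCells hF
    -- the boundary of the missing simplex `insert a F`
    have hval : simplicialBoundary (coneOperator a (Finsupp.single F r)) =
        Finsupp.single F r - coneOperator a (simplicialBoundary (Finsupp.single F r)) :=
      eq_sub_of_add_eq (boundary_coneOperator_add ha _)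
    have hcone : coneOperator a (simplicialBoundary (Finsupp.single F r)) =
        r • ∑ v ∈ F, (-1 : ℚ) ^ (F.filter (· < v)).card •
          Finsupp.single (insert a (F.erase v)) (1 : ℚ) := by
      rw [simplicialBoundary_single, map_smul, map_sum]
      congr 1
      refine Finset.sum_congr rfl fun v _ => ?_
      rw [map_smul, coneOperator_single_of_notMem fun h => haF (Finset.mem_of_mem_erase h)]
    refine ⟨⟨simplicialBoundary (coneOperator a (Finsupp.single F r)), ?_,
      simplicialBoundary_simplicialBoundary _⟩, ?_⟩
    · rw [hval, hcone]
      refine Submodule.sub_mem _ (Finsupp.single_mem_supported _ _ ⟨hF.1, hcard⟩)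
        (Submodule.smul_mem _ _ (Submodule.sum_mem _ fun v hv => Submodule.smul_mem _ _
          (Finsupp.single_mem_supported _ _ ⟨hK.insert_erase_mem F hF.1 hF.2 v hv, ?_⟩)))
      rw [Finset.card_insert_of_notMem fun h => haF (Finset.mem_of_mem_erase h),
        Finset.card_erase_add_one hv, hcard]
    · ext ⟨G, hG, hGcard⟩
      simp only [restrictToCells, LinearMap.comp_apply, Submodule.subtype_apply,
        Finsupp.lsubtypeDomain_apply, Finsupp.subtypeDomain_apply, hval, hcone,
        Finsupp.sub_apply, Finsupp.smul_apply, Finsupp.finsetSum_apply]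
      rw [Finset.sum_eq_zero, smul_zero, sub_zero]
      · simp only [Finsupp.single_apply, Subtype.mk.injEq]
      · intro v _
        rw [Finsupp.single_apply, if_neg, smul_zero]
        rintro rfl
        exact apex_notMem_of_mem_coneCells hG (Finset.mem_insert_self _ _)

theorem rank_reducedHomology_of_isAlmostCone (ha : ∀ v, a ≤ v) (hK : IsAlmostCone K a)
    (hfin : K.faces.Finite) (n : ℕ) :
    Module.rank ℚ (ReducedHomology K n) =
      ({F | F ∈ coneCells K a ∧ F.card = n + 1}.ncard : Cardinal) := by
  have hT : {F | F ∈ coneCells K a ∧ F.card = n + 1}.Finite := hfin.subset fun F hF => hF.1.1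
  rw [((Submodule.quotEquivOfEq _ _ (ker_restrictToCells ha hK n).symm).trans
      ((restrictToCells K a n).quotKerEquivOfSurjective
        (restrictToCells_surjective ha hK n))).rank_eq, rank_finsupp_self,
    ← Set.cast_ncard hT, Cardinal.lift_natCast]

end HomologyOfAlmostCone

/-! ### Collapsing maps and a simple case of van Kampen's theorem -/

section Collapse

open scoped unitInterval

variable {X B : Type*} [TopologicalSpace X] [TopologicalSpace B]

/-- A surjection `f` from a compact space onto a Hausdorff space is a homotopy equivalence if
there is a deformation of `X` which respects the fibres of `f` after applying `f` and whose final
stage is constant on these fibres. -/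
theorem nonempty_homotopyEquiv_of_collapse [CompactSpace X] [T2Space B] (f : C(X, B))
    (hf : Function.Surjective f) (H : C(I × X, X)) (H_zero : ∀ x, H (0, x) = x)
    (H_one : ∀ x y, f x = f y → H (1, x) = H (1, y))
    (H_fibre : ∀ s x y, f x = f y → f (H (s, x)) = f (H (s, y))) :
    Nonempty (X ≃ₕ B) := by
  have hq : Topology.IsQuotientMap f :=
    f.continuous.isClosedMap.isQuotientMap f.continuous hf
  let F : C(I × X, I × B) := ContinuousMap.prodMap (ContinuousMap.id I) f
  have hFs : Function.Surjective F := fun ⟨s, b⟩ =>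
    ⟨(s, (hf b).choose), Prod.ext rfl (hf b).choose_spec⟩
  -- `I × X` is compact too, so that homotopies descend along `f` as well
  have hF : Topology.IsQuotientMap F :=
    F.continuous.isClosedMap.isQuotientMap F.continuous hFs
  let H1 : C(X, X) := H.comp ((ContinuousMap.const X 1).prodMk (ContinuousMap.id X))
  let g : C(B, X) := hq.lift H1 fun x y h => H_one x y h
  have hg : ∀ x, g (f x) = H (1, x) := fun x =>
    DFunLike.congr_fun (hq.lift_comp H1 fun x y h => H_one x y h) x
  have hfac : Function.FactorsThrough (f.comp H) F := by
    rintro ⟨s, x⟩ ⟨t, y⟩ h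
    obtain ⟨rfl, h⟩ := Prod.ext_iff.1 h
    exact H_fibre s x y h
  let K : C(I × B, B) := hF.lift (f.comp H) hfac
  have hK : ∀ s x, K (s, f x) = f (H (s, x)) := fun s x =>
    DFunLike.congr_fun (hF.lift_comp (f.comp H) hfac) (s, x)
  refine ⟨⟨f, g, ContinuousMap.Homotopic.symm ⟨⟨H, fun x => H_zero x, fun x => (hg x).symm⟩⟩,
    ContinuousMap.Homotopic.symm ⟨⟨K, fun b => ?_, fun b => ?_⟩⟩⟩⟩
  · obtain ⟨x, rfl⟩ := hf b
    exact (hK 0 x).trans (congrArg f (H_zero x))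
  · obtain ⟨x, rfl⟩ := hf b
    exact (hK 1 x).trans (congrArg f (hg x).symm)

end Collapse

section SimplyConnectedCover

open scoped unitInterval Topology

variable {X : Type*} [TopologicalSpace X]

theorem IsSimplyConnected.homotopic_of_forall_mem {s : Set X} (hs : IsSimplyConnected s) {x y : X}
    (p r : Path x y) (hp : ∀ t, p t ∈ s) (hr : ∀ t, r t ∈ s) : p.Homotopic r := by
  have hsc : SimplyConnectedSpace s := hs
  have hx : x ∈ s := by simpa using hp 0
  have hy : y ∈ s := by simpa using hp 1
  let p' : Path (⟨x, hx⟩ : s) ⟨y, hy⟩ := ⟨⟨fun t => ⟨p t, hp t⟩, by fun_prop⟩, by simp, by simp⟩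
  let r' : Path (⟨x, hx⟩ : s) ⟨y, hy⟩ := ⟨⟨fun t => ⟨r t, hr t⟩, by fun_prop⟩, by simp, by simp⟩
  exact (SimplyConnectedSpace.paths_homotopic p' r').map ⟨Subtype.val, continuous_subtype_val⟩

theorem path_trans_mem {s : Set X} {x y z : X} {p : Path x y} {r : Path y z}
    (hp : ∀ t, p t ∈ s) (hr : ∀ t, r t ∈ s) (t : I) : p.trans r t ∈ s := by
  have ht : p.trans r t ∈ Set.range (p.trans r) := Set.mem_range_self t
  rw [Path.trans_range] at ht
  rcases ht with ⟨t', ht'⟩ | ⟨t', ht'⟩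
  · exact ht' ▸ hp t'
  · exact ht' ▸ hr t'

/-- Suppose that classes `c y` of paths from `x₀` to the points `y` are compatible with all paths
that lie in a member of an open cover. Then they are compatible with all paths. -/
theorem trans_eq_of_open_cover {x₀ : X} (c : ∀ y, Path.Homotopic.Quotient x₀ y)
    (hc : ∀ x, ∃ W : Set X, IsOpen W ∧ x ∈ W ∧ ∀ (y z : X) (γ : Path y z), (∀ t, γ t ∈ W) →
      (c y).trans (.mk γ) = c z)
    {y z : X} (γ : Path y z) : (c y).trans (.mk γ) = c z := by
  suffices h : ∀ t t' : I, (c (γ t)).trans (.mk (γ.subpath t t')) = c (γ t') by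
    have h1 := h 0 1
    rw [Path.subpath_zero_one] at h1
    obtain ⟨γ, rfl, rfl⟩ := γ
    exact h1
  refine PreconnectedSpace.induction₂' _ (fun t => ?_) ⟨fun t t' t'' h h' => ?_⟩
  · obtain ⟨W, hWo, htW, hW⟩ := hc (γ t)
    have hnhds : γ ⁻¹' W ∈ 𝓝 t := (hWo.preimage γ.continuous).mem_nhds htW
    have hev : ∀ᶠ t' in 𝓝 t, Set.uIcc t t' ⊆ γ ⁻¹' W :=
      Filter.tendsto_smallSets_iff.1 (tendsto_const_nhds.uIcc Filter.tendsto_id) _ hnhds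
    filter_upwards [hev] with t' ht'
    constructor
    · refine hW _ _ _ fun s => ?_
      have hs : γ.subpath t t' s ∈ Set.range (γ.subpath t t') := Set.mem_range_self s
      rw [Path.range_subpath] at hs
      exact Set.image_subset_iff.2 ht' hs
    · refine hW _ _ _ fun s => ?_
      have hs : γ.subpath t' t s ∈ Set.range (γ.subpath t' t) := Set.mem_range_self s
      rw [Path.range_subpath, Set.uIcc_comm] at hs
      exact Set.image_subset_iff.2 ht' hs
  · have h2 : Path.Homotopic.Quotient.mk (γ.subpath t t'') =
        (Path.Homotopic.Quotient.mk (γ.subpath t t')).trans (.mk (γ.subpath t' t'')) := by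
      rw [← Path.Homotopic.Quotient.mk_trans, Path.Homotopic.Quotient.eq]
      exact ⟨(Path.Homotopy.subpathTransSubpath γ t t' t'').symm⟩
    rw [h2, ← h', ← h]
    simp

/-- A simple case of the theorem of van Kampen: a space covered by a simply connected open set `U`
and disjoint simply connected open sets, each of which meets `U` in a path connected set, is simply
connected. A compatible family of classes of paths from a base point is obtained by joining it to
the points of `U` within `U`, and to the points of the other sets by passing from `U` to them
once. -/
theorem simplyConnectedSpace_of_open_cover {ι : Type*} (U : Set X) (V : ι → Set X)
    (hUo : IsOpen U) (hVo : ∀ i, IsOpen (V i)) (hcover : ∀ x, x ∈ U ∨ ∃ i, x ∈ V i)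
    (hdisj : ∀ i j x, x ∈ V i → x ∈ V j → i = j) (hU : IsSimplyConnected U)
    (hV : ∀ i, IsSimplyConnected (V i)) (hUV : ∀ i, IsPathConnected (U ∩ V i)) :
    SimplyConnectedSpace X := by
  obtain ⟨x₀, hx₀⟩ := hU.nonempty
  have key : ∀ y, ∃ c : Path.Homotopic.Quotient x₀ y,
      (∀ p : Path x₀ y, (∀ t, p t ∈ U) → c = .mk p) ∧
      ∀ i, ∀ u ∈ U ∩ V i, ∀ (p : Path x₀ u) (r : Path u y), (∀ t, p t ∈ U) → (∀ t, r t ∈ V i) →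
        c = (Path.Homotopic.Quotient.mk p).trans (.mk r) := by
    intro y
    by_cases hy : y ∈ U
    · obtain ⟨p₀, hp₀⟩ := hU.isPathConnected.joinedIn x₀ hx₀ y hy
      refine ⟨.mk p₀, fun p hp => Path.Homotopic.Quotient.eq.2
        (hU.homotopic_of_forall_mem _ _ hp₀ hp), fun i u hu p r hp hr => ?_⟩
      have hyi : y ∈ V i := by simpa using hr 1
      -- the second part of the detour through `V i` can be replaced by a path in `U ∩ V i`
      obtain ⟨δ, hδ⟩ := (hUV i).joinedIn u hu y ⟨hy, hyi⟩
      rw [Path.Homotopic.Quotient.eq.2 ((hV i).homotopic_of_forall_mem r δ hr fun t => (hδ t).2),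
        ← Path.Homotopic.Quotient.mk_trans, Path.Homotopic.Quotient.eq]
      refine hU.homotopic_of_forall_mem _ _ hp₀ fun t => ?_
      exact path_trans_mem hp (fun t => (hδ t).1) t
    · obtain ⟨i, hi⟩ := (hcover y).resolve_left hy
      obtain ⟨u, hu⟩ := (hUV i).nonempty
      obtain ⟨p₀, hp₀⟩ := hU.isPathConnected.joinedIn x₀ hx₀ u hu.1
      obtain ⟨r₀, hr₀⟩ := (hV i).isPathConnected.joinedIn u hu.2 y hi
      refine ⟨(Path.Homotopic.Quotient.mk p₀).trans (.mk r₀), fun p hp => absurd ?_ hy,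
        fun j u' hu' p r hp hr => ?_⟩
      · simpa using hp 1
      obtain rfl : i = j := hdisj i j y hi (by simpa using hr 1)
      -- two choices of the passage from `U` to `V i` are compared by a path in `U ∩ V i`
      obtain ⟨δ, hδ⟩ := (hUV i).joinedIn u hu u' hu'
      have h1 : Path.Homotopic.Quotient.mk p = (Path.Homotopic.Quotient.mk p₀).trans (.mk δ) := by
        rw [← Path.Homotopic.Quotient.mk_trans, Path.Homotopic.Quotient.eq]
        refine hU.homotopic_of_forall_mem _ _ hp fun t => ?_
        exact path_trans_mem hp₀ (fun t => (hδ t).1) t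
      have h2 : Path.Homotopic.Quotient.mk r₀ = (Path.Homotopic.Quotient.mk δ).trans (.mk r) := by
        rw [← Path.Homotopic.Quotient.mk_trans, Path.Homotopic.Quotient.eq]
        refine (hV i).homotopic_of_forall_mem _ _ hr₀ fun t => ?_
        exact path_trans_mem (fun t => (hδ t).2) hr t
      rw [h1, h2]
      simp
  choose c hcU hcV using key
  have hc : ∀ {y z : X} (γ : Path y z), (c y).trans (.mk γ) = c z := by
    refine fun {y z} γ => trans_eq_of_open_cover c (fun x => ?_) γ
    rcases hcover x with hx | ⟨i, hx⟩
    · refine ⟨U, hUo, hx, fun y z γ hγ => ?_⟩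
      obtain ⟨p, hp⟩ := hU.isPathConnected.joinedIn x₀ hx₀ y (by simpa using hγ 0)
      rw [hcU y p hp, ← Path.Homotopic.Quotient.mk_trans]
      refine (hcU z _ fun t => ?_).symm
      exact path_trans_mem hp hγ t
    · refine ⟨V i, hVo i, hx, fun y z γ hγ => ?_⟩
      obtain ⟨u, hu⟩ := (hUV i).nonempty
      obtain ⟨p, hp⟩ := hU.isPathConnected.joinedIn x₀ hx₀ u hu.1
      obtain ⟨r, hr⟩ := (hV i).isPathConnected.joinedIn u hu.2 y (by simpa using hγ 0)
      rw [hcV y i u hu p r hp hr, hcV z i u hu p (r.trans γ) hp fun t => ?_]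
      · simp
      · exact path_trans_mem hr hγ t
  refine simply_connected_iff_paths_homotopic'.2 ⟨⟨⟨x₀⟩, fun y z => ?_⟩, fun {y z} p r => ?_⟩
  · have hj : ∀ y, Joined x₀ y := fun y => ⟨(Path.Homotopic.Quotient.mk_surjective (c y)).choose⟩
    exact (hj y).symm.trans (hj z)
  · have h := congrArg (fun d => (c y).symm.trans d) ((hc p).trans (hc r).symm)
    rw [← Path.Homotopic.Quotient.eq]
    simpa [← Path.Homotopic.Quotient.trans_assoc] using h

end SimplyConnectedCover

/-! ### Simplices in barycentric coordinates -/

section Simplices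

variable {V : Type*}

/-- The closed simplex spanned by the vertices in `F`, in barycentric coordinates. -/
def faceSimplex (F : Finset V) : Set (V → ℝ) :=
  {x | (∀ v, 0 ≤ x v) ∧ (∀ v, v ∉ F → x v = 0) ∧ ∑ v ∈ F, x v = 1}

theorem mem_geometricRealization {K : PreAbstractSimplicialComplex V} {x : V → ℝ} :
    x ∈ geometricRealization K ↔ ∃ F ∈ K.faces, x ∈ faceSimplex F :=
  Iff.rfl

theorem convex_faceSimplex (F : Finset V) : Convex ℝ (faceSimplex F) := by
  intro x hx y hy s t hs ht hst
  refine ⟨fun v => ?_, fun v hv => ?_, ?_⟩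
  · exact add_nonneg (mul_nonneg hs (hx.1 v)) (mul_nonneg ht (hy.1 v))
  · simp [hx.2.1 v hv, hy.2.1 v hv]
  · simp only [Pi.add_apply, Pi.smul_apply, smul_eq_mul, Finset.sum_add_distrib, ← Finset.mul_sum,
      hx.2.2, hy.2.2, mul_one, hst]

theorem faceSimplex_mono {F G : Finset V} (h : F ⊆ G) : faceSimplex F ⊆ faceSimplex G :=
  fun x hx => ⟨hx.1, fun v hv => hx.2.1 v fun hvF => hv (h hvF), by
    rw [← Finset.sum_subset h fun v _ hv => hx.2.1 v hv, hx.2.2]⟩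

theorem isClosed_faceSimplex (F : Finset V) : IsClosed (faceSimplex F) := by
  simp only [faceSimplex, Set.ofPred_and, Set.ofPred_forall]
  refine (isClosed_iInter fun v => ?_).inter
    ((isClosed_iInter fun v => isClosed_iInter fun _ => ?_).inter ?_)
  · exact isClosed_le continuous_const (continuous_apply v)
  · exact isClosed_eq (continuous_apply v) continuous_const
  · exact isClosed_eq (by fun_prop) continuous_const

theorem le_one_of_mem_faceSimplex {F : Finset V} {x : V → ℝ} (hx : x ∈ faceSimplex F) (v : V) :
    x v ≤ 1 := by
  by_cases hv : v ∈ F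
  · exact (Finset.single_le_sum (fun u _ => hx.1 u) hv).trans_eq hx.2.2
  · simp [hx.2.1 v hv]

theorem isCompact_faceSimplex (F : Finset V) : IsCompact (faceSimplex F) :=
  (isCompact_univ_pi fun _ : V => isCompact_Icc (a := (0 : ℝ)) (b := 1)).of_isClosed_subset
    (isClosed_faceSimplex F) fun _ hx v _ => ⟨hx.1 v, le_one_of_mem_faceSimplex hx v⟩

theorem isCompact_geometricRealization {K : PreAbstractSimplicialComplex V}
    (hfin : K.faces.Finite) : IsCompact (geometricRealization K) := by
  have h : geometricRealization K = ⋃ F ∈ K.faces, faceSimplex F := by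
    ext x
    simp [mem_geometricRealization]
  rw [h]
  exact hfin.isCompact_biUnion fun F _ => isCompact_faceSimplex F

theorem single_mem_faceSimplex [DecidableEq V] {F : Finset V} {a : V} (ha : a ∈ F) :
    (Pi.single a 1 : V → ℝ) ∈ faceSimplex F := by
  refine ⟨fun v => ?_, fun v hv => ?_, ?_⟩
  · rw [Pi.single_apply]
    split_ifs <;> norm_num
  · rw [Pi.single_apply, if_neg]
    rintro rfl
    exact hv ha
  · simp [Finset.sum_pi_single', ha]

open Classical in
/-- The normalized distance of `x` from the boundary of the simplex spanned by `F`: the least of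
the coordinates at `F`, scaled so that it is `1` at the barycentre. -/
noncomputable def cellDepth (F : Finset V) (x : V → ℝ) : ℝ :=
  if h : F.Nonempty then F.card * F.inf' h x else 0

theorem continuous_cellDepth (F : Finset V) : Continuous (cellDepth F) := by
  unfold cellDepth
  split_ifs with h
  · exact continuous_const.mul (Continuous.finset_inf'_apply h fun v _ => continuous_apply v)
  · exact continuous_const

theorem cellDepth_le {F : Finset V} {v : V} (hv : v ∈ F) (x : V → ℝ) :
    cellDepth F x ≤ F.card * x v := by
  rw [cellDepth, dif_pos ⟨v, hv⟩]
  exact mul_le_mul_of_nonneg_left (Finset.inf'_le x hv) (Nat.cast_nonneg _)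

theorem exists_cellDepth_eq {F : Finset V} (hF : F.Nonempty) (x : V → ℝ) :
    ∃ v ∈ F, cellDepth F x = F.card * x v := by
  obtain ⟨v, hv, h⟩ := Finset.exists_mem_eq_inf' hF x
  exact ⟨v, hv, by rw [cellDepth, dif_pos hF, h]⟩

theorem cellDepth_nonneg (F : Finset V) {x : V → ℝ} (hx : ∀ v, 0 ≤ x v) : 0 ≤ cellDepth F x := by
  rcases F.eq_empty_or_nonempty with rfl | hF
  · simp [cellDepth]
  · obtain ⟨v, -, h⟩ := exists_cellDepth_eq hF x
    rw [h]
    exact mul_nonneg (Nat.cast_nonneg _) (hx v)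

theorem pos_of_cellDepth_pos {F : Finset V} {x : V → ℝ} (h : 0 < cellDepth F x) {v : V}
    (hv : v ∈ F) : 0 < x v :=
  pos_of_mul_pos_right (h.trans_le (cellDepth_le hv x)) (Nat.cast_nonneg _)

theorem cellDepth_pos {F : Finset V} {x : V → ℝ} (hF : F.Nonempty) (h : ∀ v ∈ F, 0 < x v) :
    0 < cellDepth F x := by
  obtain ⟨v, hv, hx⟩ := exists_cellDepth_eq hF x
  rw [hx]
  exact mul_pos (Nat.cast_pos.2 hF.card_pos) (h v hv)

/-- The map that moves the points of the simplex spanned by `F` away from its barycentre: it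
decreases the depth by subtracting a multiple of the barycentre and rescales. -/
noncomputable def cellPush (F : Finset V) (b : ℝ) (x : V → ℝ) : V → ℝ :=
  (1 - b)⁻¹ • (x - (b / F.card) • (F : Set V).indicator 1)

theorem cellPush_zero (F : Finset V) (x : V → ℝ) : cellPush F 0 x = x := by
  simp [cellPush]

theorem cellPush_apply_of_mem {F : Finset V} {v : V} (hv : v ∈ F) (b : ℝ) (x : V → ℝ) :
    cellPush F b x v = (1 - b)⁻¹ * (x v - b / F.card) := by
  simp [cellPush, hv]

theorem cellPush_apply_of_notMem {F : Finset V} {v : V} (hv : v ∉ F) (b : ℝ) (x : V → ℝ) :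
    cellPush F b x v = (1 - b)⁻¹ * x v := by
  simp [cellPush, hv]

theorem cellPush_mem_faceSimplex {F : Finset V} (hF : F.Nonempty) {b : ℝ} {x : V → ℝ}
    (hx : x ∈ faceSimplex F) (hb : b ≤ cellDepth F x) (hb1 : b < 1) :
    cellPush F b x ∈ faceSimplex F := by
  have hc : (0 : ℝ) < F.card := Nat.cast_pos.2 hF.card_pos
  have h1 : 0 < 1 - b := by linarith
  refine ⟨fun v => ?_, fun v hv => ?_, ?_⟩
  · by_cases hv : v ∈ F
    · rw [cellPush_apply_of_mem hv]
      refine mul_nonneg (inv_nonneg.2 h1.le) (sub_nonneg.2 ?_)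
      rw [div_le_iff₀' hc]
      exact hb.trans (cellDepth_le hv x)
    · rw [cellPush_apply_of_notMem hv, hx.2.1 v hv, mul_zero]
  · rw [cellPush_apply_of_notMem hv, hx.2.1 v hv, mul_zero]
  · rw [Finset.sum_congr rfl fun v hv => cellPush_apply_of_mem hv b x, ← Finset.mul_sum,
      Finset.sum_sub_distrib, hx.2.2, Finset.sum_const, nsmul_eq_mul, mul_div_cancel₀ _ hc.ne',
      inv_mul_cancel₀ h1.ne']

/-- A point that is pushed as far as possible reaches the boundary of the simplex. -/
theorem exists_cellPush_mem_faceSimplex_erase [DecidableEq V] {F : Finset V} (hF : F.Nonempty)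
    {x : V → ℝ} (hx : x ∈ faceSimplex F) (h1 : cellDepth F x < 1) :
    ∃ v ∈ F, cellPush F (cellDepth F x) x ∈ faceSimplex (F.erase v) := by
  obtain ⟨v, hv, h⟩ := exists_cellDepth_eq hF x
  have hp := cellPush_mem_faceSimplex hF hx le_rfl h1
  have hz : cellPush F (cellDepth F x) x v = 0 := by
    rw [cellPush_apply_of_mem hv, h,
      mul_div_cancel_left₀ _ (Nat.cast_ne_zero.2 hF.card_pos.ne'), sub_self, mul_zero]
  refine ⟨v, hv, hp.1, fun u hu => ?_, ?_⟩
  · by_cases huv : u = v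
    · rw [huv, hz]
    · exact hp.2.1 u fun huF => hu (Finset.mem_erase.2 ⟨huv, huF⟩)
  · rw [Finset.sum_erase _ hz, hp.2.2]

/-- Pushing away from the barycentre does not lead to the barycentre, even if one stops on the
way. -/
theorem cellDepth_segment_lt_one {F : Finset V} (hF : F.Nonempty) {x : V → ℝ}
    {b : ℝ} (hb0 : 0 ≤ b) (hb : b ≤ cellDepth F x) (h1 : cellDepth F x < 1) {s : ℝ} (hs : 0 ≤ s) :
    cellDepth F ((1 - s) • x + s • cellPush F b x) < 1 := by
  have hc : (0 : ℝ) < F.card := Nat.cast_pos.2 hF.card_pos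
  obtain ⟨v, hv, h⟩ := exists_cellDepth_eq hF x
  refine (cellDepth_le hv _).trans_lt ?_
  have h1b : 0 < 1 - b := by linarith
  have hpush : F.card * cellPush F b x v ≤ cellDepth F x := by
    rw [cellPush_apply_of_mem hv, mul_left_comm, mul_sub, ← h, mul_div_cancel₀ _ hc.ne',
      inv_mul_le_iff₀ h1b]
    nlinarith
  simp only [Pi.add_apply, Pi.smul_apply, smul_eq_mul]
  nlinarith

theorem cellDepth_nonneg_of_mem {V : Type*} {K : PreAbstractSimplicialComplex V} (F : Finset V)
    {x : V → ℝ} (hx : x ∈ geometricRealization K) :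
    0 ≤ cellDepth F x := by
  obtain ⟨G, -, hG⟩ := hx
  exact cellDepth_nonneg F hG.1

end Simplices

section CellsInRealization

variable {V : Type*} [DecidableEq V] {K : PreAbstractSimplicialComplex V} {a : V}

theorem IsAlmostCone.eq_of_cellDepth_pos (hK : IsAlmostCone K a) {F G : Finset V} {x : V → ℝ}
    (hF : F ∈ coneCells K a) (hG : G ∈ K.faces) (hx : x ∈ faceSimplex G)
    (h : 0 < cellDepth F x) : G = F := by
  refine hK.eq_of_subset hF hG fun v hv => ?_
  by_contra hvG
  exact (pos_of_cellDepth_pos h hv).ne' (hx.2.1 v hvG)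

theorem IsAlmostCone.mem_faceSimplex_of_cellDepth_pos (hK : IsAlmostCone K a) {F : Finset V}
    {x : V → ℝ} (hF : F ∈ coneCells K a) (hx : x ∈ geometricRealization K)
    (h : 0 < cellDepth F x) : x ∈ faceSimplex F := by
  obtain ⟨G, hG, hxG⟩ := hx
  rwa [← hK.eq_of_cellDepth_pos hF hG hxG h]

theorem IsAlmostCone.cellDepth_eq_zero_of_ne (hK : IsAlmostCone K a) {F G : Finset V} {x : V → ℝ}
    (hF : F ∈ coneCells K a) (hG : G ∈ coneCells K a) (hx : x ∈ faceSimplex F) (hne : G ≠ F) :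
    cellDepth G x = 0 :=
  ((cellDepth_nonneg G hx.1).eq_or_lt.resolve_right fun h =>
    hne (hK.eq_of_cellDepth_pos hG hF.1 hx h).symm).symm

/-- The points of the cone: those which are not in the interior of a simplex outside the cone. -/
def coneOf (K : PreAbstractSimplicialComplex V) (a : V) : Set (V → ℝ) :=
  {x | x ∈ geometricRealization K ∧ ∀ F ∈ coneCells K a, cellDepth F x = 0}

theorem IsAlmostCone.mem_coneOf_iff (hK : IsAlmostCone K a) {x : V → ℝ} :
    x ∈ coneOf K a ↔ ∃ G ∈ K.faces, a ∈ G ∧ x ∈ faceSimplex G := by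
  constructor
  · rintro ⟨⟨G, hG, hxG⟩, h⟩
    -- the support of `x`
    have hsub : G.filter (fun v => x v ≠ 0) ⊆ G := Finset.filter_subset _ _
    have hx : x ∈ faceSimplex (G.filter fun v => x v ≠ 0) := by
      refine ⟨hxG.1, fun v hv => ?_, ?_⟩
      · by_contra hne
        exact hv (Finset.mem_filter.2 ⟨by_contra fun hvG => hne (hxG.2.1 v hvG), hne⟩)
      · rw [Finset.sum_filter_ne_zero, hxG.2.2]
    have hne : (G.filter fun v => x v ≠ 0).Nonempty := by
      by_contra hemp
      have := hx.2.2
      rw [Finset.not_nonempty_iff_eq_empty.1 hemp] at this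
      simp at this
    refine ⟨_, by_contra fun hc => ?_, Finset.mem_insert_self a _,
      faceSimplex_mono (Finset.subset_insert a _) hx⟩
    refine (cellDepth_pos hne fun v hv => ?_).ne' (h _ ⟨face_of_subset hG hsub hne, hc⟩)
    exact lt_of_le_of_ne (hxG.1 v) (Finset.mem_filter.1 hv).2.symm
  · rintro ⟨G, hG, haG, hxG⟩
    refine ⟨⟨G, hG, hxG⟩, fun F hF => ((cellDepth_nonneg F hxG.1).eq_or_lt.resolve_right
      fun h => ?_).symm⟩
    rw [hK.eq_of_cellDepth_pos hF hG hxG h] at haG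
    exact apex_notMem_of_mem_coneCells hF haG

theorem IsAlmostCone.single_mem_coneOf (hK : IsAlmostCone K a) : Pi.single a 1 ∈ coneOf K a :=
  hK.mem_coneOf_iff.2 ⟨{a}, hK.apex_mem, Finset.mem_singleton_self a,
    single_mem_faceSimplex (Finset.mem_singleton_self a)⟩

theorem mem_coneOf_or_exists_mem_coneCells {x : V → ℝ} (hx : x ∈ geometricRealization K) :
    x ∈ coneOf K a ∨ ∃ F ∈ coneCells K a, 0 < cellDepth F x := by
  by_cases h : ∃ F ∈ coneCells K a, 0 < cellDepth F x
  · exact Or.inr h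
  · push Not at h
    exact Or.inl ⟨hx, fun F hF => le_antisymm (h F hF) (cellDepth_nonneg_of_mem F hx)⟩

end CellsInRealization

/-! ### Coordinates on open simplices and stereographic projection -/

section CellPoints

variable {V : Type*}

open Classical in
/-- The point of the open simplex spanned by `F` which lies in the direction `w` (of coordinate sum
zero on `F`) from the barycentre. The scaling makes this a bijection from the vectors of
coordinate sum zero to the open simplex. -/
noncomputable def cellPoint (F : Finset V) (w : V → ℝ) : V → ℝ := fun v =>
  if v ∈ F then (F.card : ℝ)⁻¹ + (1 - cellDepth F w)⁻¹ * w v else 0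

theorem cellPoint_apply_of_mem {F : Finset V} {v : V} (hv : v ∈ F) (w : V → ℝ) :
    cellPoint F w v = (F.card : ℝ)⁻¹ + (1 - cellDepth F w)⁻¹ * w v :=
  if_pos hv

theorem cellDepth_nonpos_of_sum_eq_zero {F : Finset V} {w : V → ℝ} (hw : ∑ v ∈ F, w v = 0) :
    cellDepth F w ≤ 0 := by
  rcases F.eq_empty_or_nonempty with rfl | hF
  · simp [cellDepth]
  · by_contra! h
    exact (Finset.sum_pos (fun v hv => pos_of_cellDepth_pos h hv) hF).ne' hw

theorem cellPoint_mem_faceSimplex {F : Finset V} (hF : F.Nonempty) {w : V → ℝ}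
    (hw : ∑ v ∈ F, w v = 0) : cellPoint F w ∈ faceSimplex F := by
  have hc : (0 : ℝ) < F.card := Nat.cast_pos.2 hF.card_pos
  have hd := cellDepth_nonpos_of_sum_eq_zero hw
  have h1 : 0 < 1 - cellDepth F w := by linarith
  refine ⟨fun v => ?_, fun v hv => if_neg hv, ?_⟩
  · by_cases hv : v ∈ F
    · rw [cellPoint_apply_of_mem hv]
      have h2 := cellDepth_le hv w
      have h3 : (F.card : ℝ)⁻¹ + (1 - cellDepth F w)⁻¹ * w v =
          ((1 - cellDepth F w) + F.card * w v) / (F.card * (1 - cellDepth F w)) := by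
        field_simp
      rw [h3]
      exact div_nonneg (by linarith) (by positivity)
    · exact (if_neg hv).ge
  · rw [Finset.sum_congr rfl fun v hv => cellPoint_apply_of_mem hv w, Finset.sum_add_distrib,
      ← Finset.mul_sum, hw, Finset.sum_const, nsmul_eq_mul, mul_inv_cancel₀ hc.ne', mul_zero,
      add_zero]

theorem cellDepth_cellPoint {F : Finset V} (hF : F.Nonempty) {w : V → ℝ}
    (hw : ∑ v ∈ F, w v = 0) : cellDepth F (cellPoint F w) = (1 - cellDepth F w)⁻¹ := by
  have hc : (0 : ℝ) < F.card := Nat.cast_pos.2 hF.card_pos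
  have hd := cellDepth_nonpos_of_sum_eq_zero hw
  have h1 : 0 < 1 - cellDepth F w := by linarith
  have hval : ∀ v ∈ F, F.card * cellPoint F w v = 1 + (1 - cellDepth F w)⁻¹ * (F.card * w v) := by
    intro v hv
    rw [cellPoint_apply_of_mem hv]
    field_simp
  have heq : 1 + (1 - cellDepth F w)⁻¹ * cellDepth F w = (1 - cellDepth F w)⁻¹ := by
    field_simp
    ring
  refine le_antisymm ?_ ?_
  · obtain ⟨v, hv, h⟩ := exists_cellDepth_eq hF w
    refine (cellDepth_le hv _).trans_eq ?_
    rw [hval v hv, ← h, heq]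
  · obtain ⟨v, hv, h⟩ := exists_cellDepth_eq hF (cellPoint F w)
    rw [h, hval v hv]
    have := mul_le_mul_of_nonneg_left (cellDepth_le hv w) (inv_nonneg.2 h1.le)
    linarith

theorem continuousOn_cellPoint (F : Finset V) :
    ContinuousOn (cellPoint F) {w | ∑ v ∈ F, w v = 0} := by
  rw [continuousOn_pi]
  intro v
  by_cases hv : v ∈ F
  · simp only [cellPoint_apply_of_mem hv]
    refine continuousOn_const.add (ContinuousOn.mul (ContinuousOn.inv₀ ?_ fun w hw => ?_) ?_)
    · exact (continuous_const.sub (continuous_cellDepth F)).continuousOn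
    · have := cellDepth_nonpos_of_sum_eq_zero hw
      exact (by linarith : 0 < 1 - cellDepth F w).ne'
    · exact (continuous_apply v).continuousOn
  · simp only [cellPoint, if_neg hv]
    exact continuousOn_const

/-- The direction of a point of the open simplex, seen from the barycentre. It determines the
point. -/
noncomputable def cellDirection (F : Finset V) (x : V → ℝ) : V → ℝ := fun v =>
  (x v - (F.card : ℝ)⁻¹) / cellDepth F x

theorem sum_cellDirection {F : Finset V} (hF : F.Nonempty) {x : V → ℝ} (hx : x ∈ faceSimplex F) :
    ∑ v ∈ F, cellDirection F x v = 0 := by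
  have hc : (0 : ℝ) < F.card := Nat.cast_pos.2 hF.card_pos
  simp only [cellDirection]
  rw [← Finset.sum_div, Finset.sum_sub_distrib, hx.2.2, Finset.sum_const, nsmul_eq_mul,
    mul_inv_cancel₀ hc.ne', sub_self, zero_div]

theorem cellDepth_congr {F : Finset V} {x y : V → ℝ} (h : ∀ v ∈ F, x v = y v) :
    cellDepth F x = cellDepth F y := by
  unfold cellDepth
  split_ifs with hF
  · rw [Finset.inf'_congr hF rfl h]
  · rfl

theorem cellPoint_congr {F : Finset V} {x y : V → ℝ} (h : ∀ v ∈ F, x v = y v) :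
    cellPoint F x = cellPoint F y := by
  funext v
  simp only [cellPoint, cellDepth_congr h]
  split_ifs with hv
  · rw [h v hv]
  · rfl

theorem cellDepth_cellDirection {F : Finset V} (hF : F.Nonempty) {x : V → ℝ}
    (h0 : 0 < cellDepth F x) : cellDepth F (cellDirection F x) = 1 - (cellDepth F x)⁻¹ := by
  have hc : (0 : ℝ) < F.card := Nat.cast_pos.2 hF.card_pos
  have hval : ∀ v, F.card * cellDirection F x v = (F.card * x v - 1) / cellDepth F x := by
    intro v
    simp only [cellDirection]
    field_simp
  have heq : (cellDepth F x - 1) / cellDepth F x = 1 - (cellDepth F x)⁻¹ := by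
    field_simp
  refine le_antisymm ?_ ?_
  · obtain ⟨v, hv, h⟩ := exists_cellDepth_eq hF x
    refine (cellDepth_le hv _).trans_eq ?_
    rw [hval, ← h, heq]
  · obtain ⟨v, hv, h⟩ := exists_cellDepth_eq hF (cellDirection F x)
    rw [h, hval, ← heq]
    gcongr
    exact cellDepth_le hv x

theorem cellPoint_cellDirection {F : Finset V} (hF : F.Nonempty) {x : V → ℝ}
    (hx : x ∈ faceSimplex F) (h0 : 0 < cellDepth F x) : cellPoint F (cellDirection F x) = x := by
  funext v
  by_cases hv : v ∈ F
  · rw [cellPoint_apply_of_mem hv, cellDepth_cellDirection hF h0, sub_sub_cancel, inv_inv,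
      cellDirection, mul_div_cancel₀ _ h0.ne', add_sub_cancel]
  · rw [hx.2.1 v hv]
    exact if_neg hv

end CellPoints

section SpherePoint

open scoped Topology

/-- The point of the sphere `S^n` whose stereographic projection from the base point is `u / κ`;
for `κ = 0` this is the base point. -/
noncomputable def spherePoint {n : ℕ} (κ : ℝ) (u : Fin n → ℝ) : UnitSphere n :=
  if h : κ = 0 then UnitSphere.base n
  else ⟨WithLp.toLp 2 (Fin.cons ((∑ j, u j ^ 2 - κ ^ 2) / (∑ j, u j ^ 2 + κ ^ 2))
    fun j => 2 * κ * u j / (∑ j, u j ^ 2 + κ ^ 2)), by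
      have hq : 0 ≤ ∑ j, u j ^ 2 := Finset.sum_nonneg fun j _ => sq_nonneg _
      have hκ : 0 < κ ^ 2 := by positivity
      have hD : ∑ j, u j ^ 2 + κ ^ 2 ≠ 0 := by positivity
      rw [mem_sphere_zero_iff_norm, ← sq_eq_sq₀ (norm_nonneg _) zero_le_one,
        EuclideanSpace.real_norm_sq_eq, Fin.sum_univ_succ]
      simp only [Fin.cons_zero, Fin.cons_succ, div_pow, mul_pow]
      rw [← Finset.sum_div, ← Finset.mul_sum, ← add_div, div_eq_iff (pow_ne_zero 2 hD)]
      ring⟩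

theorem spherePoint_zero {n : ℕ} (u : Fin n → ℝ) : spherePoint 0 u = UnitSphere.base n :=
  dif_pos rfl

theorem coe_spherePoint {n : ℕ} {κ : ℝ} {u : Fin n → ℝ} (h : ∑ j, u j ^ 2 + κ ^ 2 ≠ 0) :
    (spherePoint κ u : EuclideanSpace ℝ (Fin (n + 1))) =
      WithLp.toLp 2 (Fin.cons ((∑ j, u j ^ 2 - κ ^ 2) / (∑ j, u j ^ 2 + κ ^ 2))
        fun j => 2 * κ * u j / (∑ j, u j ^ 2 + κ ^ 2)) := by
  by_cases hκ : κ = 0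
  · subst hκ
    rw [spherePoint_zero, UnitSphere.base]
    have hq : ∑ j, u j ^ 2 ≠ 0 := by simpa using h
    ext j
    refine Fin.cases ?_ (fun j => ?_) j
    · simp [hq]
    · simp
  · rw [spherePoint, dif_neg hκ]

theorem continuousOn_spherePoint (n : ℕ) :
    ContinuousOn (fun p : ℝ × (Fin n → ℝ) => spherePoint p.1 p.2)
      {p | ∑ j, p.2 j ^ 2 + p.1 ^ 2 ≠ 0} := by
  rw [Topology.IsInducing.subtypeVal.continuousOn_iff]
  refine ContinuousOn.congr (f := fun p : ℝ × (Fin n → ℝ) =>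
    (WithLp.toLp 2 (Fin.cons ((∑ j, p.2 j ^ 2 - p.1 ^ 2) / (∑ j, p.2 j ^ 2 + p.1 ^ 2))
        fun j => 2 * p.1 * p.2 j / (∑ j, p.2 j ^ 2 + p.1 ^ 2)) : EuclideanSpace ℝ (Fin (n + 1))))
    ?_ fun p hp => coe_spherePoint hp
  refine (PiLp.continuous_toLp 2 _).comp_continuousOn (continuousOn_pi.2 fun j => ?_)
  refine Fin.cases ?_ (fun j => ?_) j
  · simp only [Fin.cons_zero]
    exact ContinuousOn.div (by fun_prop) (by fun_prop) fun p hp => hp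
  · simp only [Fin.cons_succ]
    exact ContinuousOn.div (by fun_prop) (by fun_prop) fun p hp => hp

theorem one_sub_spherePoint_zero {n : ℕ} {κ : ℝ} (hκ : κ ≠ 0) (u : Fin n → ℝ) :
    1 - (spherePoint κ u).1 0 = 2 * κ ^ 2 / (∑ j, u j ^ 2 + κ ^ 2) := by
  have hq : 0 ≤ ∑ j, u j ^ 2 := Finset.sum_nonneg fun j _ => sq_nonneg _
  have hD : ∑ j, u j ^ 2 + κ ^ 2 ≠ 0 := by positivity
  rw [coe_spherePoint hD]
  simp only [Fin.cons_zero]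
  field_simp
  ring

theorem spherePoint_ne_base {n : ℕ} {κ : ℝ} (hκ : κ ≠ 0) (u : Fin n → ℝ) :
    spherePoint κ u ≠ UnitSphere.base n := by
  intro h
  have h1 := one_sub_spherePoint_zero hκ u
  have hq : 0 ≤ ∑ j, u j ^ 2 := Finset.sum_nonneg fun j _ => sq_nonneg _
  rw [h, UnitSphere.base, eq_comm] at h1
  simp only [PiLp.single_apply, if_true, sub_self] at h1
  have h2 : 0 < 2 * κ ^ 2 / (∑ j, u j ^ 2 + κ ^ 2) := by positivity
  exact h2.ne' h1

/-- The stereographic projection of `spherePoint κ u`. -/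
theorem spherePoint_succ_div {n : ℕ} {κ : ℝ} (hκ : κ ≠ 0) (u : Fin n → ℝ) (j : Fin n) :
    (spherePoint κ u).1 j.succ / (1 - (spherePoint κ u).1 0) = u j / κ := by
  have hq : 0 ≤ ∑ j, u j ^ 2 := Finset.sum_nonneg fun j _ => sq_nonneg _
  have hD : ∑ j, u j ^ 2 + κ ^ 2 ≠ 0 := by positivity
  rw [one_sub_spherePoint_zero hκ, coe_spherePoint hD]
  simp only [Fin.cons_succ]
  field_simp

theorem spherePoint_stereographic {n : ℕ} {P : UnitSphere n} (hP : P ≠ UnitSphere.base n) {κ : ℝ}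
    (hκ : κ ≠ 0) : spherePoint κ (fun j => κ * (P.1 j.succ / (1 - P.1 0))) = P := by
  have hnorm : P.1 0 ^ 2 + ∑ j : Fin n, P.1 j.succ ^ 2 = 1 := by
    have h := P.2
    rw [mem_sphere_zero_iff_norm, ← sq_eq_sq₀ (norm_nonneg _) zero_le_one,
      EuclideanSpace.real_norm_sq_eq, Fin.sum_univ_succ, one_pow] at h
    exact h
  have hq : 0 ≤ ∑ j : Fin n, P.1 j.succ ^ 2 := Finset.sum_nonneg fun j _ => sq_nonneg _
  have hne : P.1 0 ≠ 1 := by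
    intro h1
    rw [h1, one_pow, add_eq_left] at hnorm
    have h0 := (Finset.sum_eq_zero_iff_of_nonneg fun j _ => sq_nonneg _).1 hnorm
    refine hP (Subtype.ext ?_)
    ext j
    refine Fin.cases ?_ (fun j => ?_) j
    · simp [UnitSphere.base, h1]
    · have := h0 j (Finset.mem_univ j)
      simp [UnitSphere.base, pow_eq_zero_iff] at this ⊢
      exact this
  have h1 : 1 - P.1 0 ≠ 0 := sub_ne_zero.2 hne.symm
  have hsum : ∑ j : Fin n, (κ * (P.1 j.succ / (1 - P.1 0))) ^ 2 =
      κ ^ 2 * ((1 + P.1 0) / (1 - P.1 0)) := by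
    simp only [mul_pow, div_pow]
    rw [← Finset.mul_sum, ← Finset.sum_div, eq_sub_of_add_eq' hnorm]
    field_simp
    ring
  have hD : ∑ j : Fin n, (κ * (P.1 j.succ / (1 - P.1 0))) ^ 2 + κ ^ 2 =
      2 * κ ^ 2 / (1 - P.1 0) := by
    rw [hsum]
    field_simp
    ring
  have hD0 : ∑ j : Fin n, (κ * (P.1 j.succ / (1 - P.1 0))) ^ 2 + κ ^ 2 ≠ 0 := by
    rw [hD]
    positivity
  refine Subtype.ext ?_
  rw [coe_spherePoint hD0, hD, hsum]
  ext j
  refine Fin.cases ?_ (fun j => ?_) j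
  · simp only [Fin.cons_zero]
    field_simp
    ring
  · simp only [Fin.cons_succ]
    field_simp

end SpherePoint

/-! ### The homotopy type of an almost cone -/

section CellToSphere

variable {V : Type*} {F : Finset V} {n : ℕ}

theorem nonempty_of_equiv_fin (vert : Fin (n + 1) ≃ F) : F.Nonempty := ⟨vert 0, (vert 0).2⟩

variable (vert : Fin (n + 1) ≃ F)

theorem sum_eq_sum_fin (w : V → ℝ) : ∑ v ∈ F, w v = ∑ j, w (vert j) := by
  rw [← Finset.sum_coe_sort, ← Equiv.sum_comp vert]

open Classical in
/-- The vector of coordinate sum zero with prescribed coordinates at all vertices of `F` but one. -/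
noncomputable def zeroSumVector (c : Fin n → ℝ) : V → ℝ := fun v =>
  if h : v ∈ F then (Fin.cons (-∑ j, c j) c : Fin (n + 1) → ℝ) (vert.symm ⟨v, h⟩) else 0

theorem zeroSumVector_apply (c : Fin n → ℝ) (j : Fin (n + 1)) :
    zeroSumVector vert c (vert j) = (Fin.cons (-∑ j, c j) c : Fin (n + 1) → ℝ) j := by
  simp [zeroSumVector]

theorem sum_zeroSumVector (c : Fin n → ℝ) : ∑ v ∈ F, zeroSumVector vert c v = 0 := by
  rw [sum_eq_sum_fin vert, Fin.sum_univ_succ]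
  simp only [zeroSumVector_apply, Fin.cons_zero, Fin.cons_succ, neg_add_cancel]

theorem continuous_zeroSumVector : Continuous (zeroSumVector vert) := by
  refine continuous_pi fun v => ?_
  unfold zeroSumVector
  split_ifs with h
  · generalize vert.symm ⟨v, h⟩ = j
    refine Fin.cases ?_ (fun j => ?_) j
    · simp only [Fin.cons_zero]
      fun_prop
    · simp only [Fin.cons_succ]
      fun_prop
  · exact continuous_const

theorem eq_of_sum_eq_zero {w w' : V → ℝ} (hw : ∑ v ∈ F, w v = 0) (hw' : ∑ v ∈ F, w' v = 0)
    (h : ∀ j : Fin n, w (vert j.succ) = w' (vert j.succ)) : ∀ v ∈ F, w v = w' v := by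
  rw [sum_eq_sum_fin vert, Fin.sum_univ_succ] at hw hw'
  have h0 : w (vert 0) = w' (vert 0) := by
    rw [Finset.sum_congr rfl fun j _ => h j] at hw
    linarith
  intro v hv
  obtain ⟨j, hj⟩ := vert.surjective ⟨v, hv⟩
  have hjv : (vert j : V) = v := by rw [hj]
  rw [← hjv]
  exact Fin.cases h0 h j

/-- The map from the simplex spanned by `F` to the sphere which collapses the boundary to the base
point: the direction of a point from the barycentre is read as the stereographic projection of a
point of the sphere. -/
noncomputable def cellToSphere (x : V → ℝ) : UnitSphere n :=
  spherePoint (cellDepth F x) fun j => x (vert j.succ) - (F.card : ℝ)⁻¹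

theorem cellToSphere_of_cellDepth_eq_zero {x : V → ℝ} (h : cellDepth F x = 0) :
    cellToSphere vert x = UnitSphere.base n := by
  rw [cellToSphere, h, spherePoint_zero]

theorem cellToSphere_ne_base {x : V → ℝ} (h : 0 < cellDepth F x) :
    cellToSphere vert x ≠ UnitSphere.base n :=
  spherePoint_ne_base h.ne' _

theorem continuousOn_cellToSphere : ContinuousOn (cellToSphere vert) (faceSimplex F) := by
  refine (continuousOn_spherePoint n).comp (f := fun x : V → ℝ =>
    (cellDepth F x, fun j : Fin n => x (vert j.succ) - (F.card : ℝ)⁻¹)) ?_ fun x hx h => ?_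
  · refine Continuous.continuousOn (Continuous.prodMk (continuous_cellDepth F) ?_)
    fun_prop
  -- if the depth and all coordinates relative to the barycentre vanish, then `x` is the barycentre
  · have hF := nonempty_of_equiv_fin vert
    have hc : (0 : ℝ) < F.card := Nat.cast_pos.2 hF.card_pos
    have hq : 0 ≤ ∑ j : Fin n, (x (vert j.succ) - (F.card : ℝ)⁻¹) ^ 2 :=
      Finset.sum_nonneg fun j _ => sq_nonneg _
    have h : ∑ j : Fin n, (x (vert j.succ) - (F.card : ℝ)⁻¹) ^ 2 + cellDepth F x ^ 2 = 0 := h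
    have hd : cellDepth F x = 0 := by
      have : cellDepth F x ^ 2 = 0 := by nlinarith [sq_nonneg (cellDepth F x)]
      exact pow_eq_zero_iff two_ne_zero |>.1 this
    rw [hd, zero_pow two_ne_zero, add_zero,
      Finset.sum_eq_zero_iff_of_nonneg fun j _ => sq_nonneg _] at h
    have hsum : ∑ v ∈ F, (x v - (F.card : ℝ)⁻¹) = 0 := by
      rw [Finset.sum_sub_distrib, hx.2.2, Finset.sum_const, nsmul_eq_mul, mul_inv_cancel₀ hc.ne',
        sub_self]
    have hall := eq_of_sum_eq_zero vert (w := fun v => x v - (F.card : ℝ)⁻¹) (w' := fun _ => 0)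
      hsum (by simp) fun j => pow_eq_zero_iff two_ne_zero |>.1 (h j (Finset.mem_univ j))
    refine (cellDepth_pos hF fun v hv => ?_).ne' hd
    rw [sub_eq_zero.1 (hall v hv)]
    exact inv_pos.2 hc

theorem cellToSphere_injective {x y : V → ℝ} (hx : x ∈ faceSimplex F) (hy : y ∈ faceSimplex F)
    (hx0 : 0 < cellDepth F x) (hy0 : 0 < cellDepth F y)
    (h : cellToSphere vert x = cellToSphere vert y) : x = y := by
  have hF := nonempty_of_equiv_fin vert
  have hdir : ∀ v ∈ F, cellDirection F x v = cellDirection F y v := by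
    refine eq_of_sum_eq_zero vert (sum_cellDirection hF hx) (sum_cellDirection hF hy) fun j => ?_
    have h1 := spherePoint_succ_div hx0.ne' (fun j => x (vert j.succ) - (F.card : ℝ)⁻¹) j
    have h2 := spherePoint_succ_div hy0.ne' (fun j => y (vert j.succ) - (F.card : ℝ)⁻¹) j
    have h : spherePoint (cellDepth F x) (fun j => x (vert j.succ) - (F.card : ℝ)⁻¹) =
      spherePoint (cellDepth F y) (fun j => y (vert j.succ) - (F.card : ℝ)⁻¹) := h
    rw [h, h2] at h1
    exact h1.symm
  rw [← cellPoint_cellDirection hF hx hx0, cellPoint_congr hdir, cellPoint_cellDirection hF hy hy0]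

theorem exists_cellToSphere_eq {P : UnitSphere n} (hP : P ≠ UnitSphere.base n) :
    ∃ x ∈ faceSimplex F, cellToSphere vert x = P := by
  have hF := nonempty_of_equiv_fin vert
  have hw := sum_zeroSumVector vert fun j => P.1 j.succ / (1 - P.1 0)
  have hd := cellDepth_nonpos_of_sum_eq_zero hw
  refine ⟨_, cellPoint_mem_faceSimplex hF hw, ?_⟩
  rw [cellToSphere, cellDepth_cellPoint hF hw]
  simp only [cellPoint_apply_of_mem (vert _).2, zeroSumVector_apply, Fin.cons_succ,
    add_sub_cancel_left]
  exact spherePoint_stereographic hP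
    (inv_ne_zero (by linarith : 0 < 1 - cellDepth F _).ne')

end CellToSphere

section BouquetTopology

variable {ι : Type*} (d : ι → ℕ)

open Classical in
/-- The map from the bouquet to the product of the spheres, which sends every sphere to the
corresponding axis. Being injective and continuous, it shows that the bouquet is Hausdorff. -/
noncomputable def bouquetToPi : Bouquet d → ∀ i, UnitSphere (d i) :=
  Quot.lift (Sum.elim (fun _ i => UnitSphere.base (d i))
    fun p => Function.update (fun i => UnitSphere.base (d i)) p.1 p.2) (by
      rintro _ _ ⟨i⟩
      exact (Function.update_eq_self i _).symm)

open Classical in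
theorem bouquetToPi_inr (i : ι) (P : UnitSphere (d i)) :
    bouquetToPi d (Quot.mk _ (Sum.inr ⟨i, P⟩)) =
      Function.update (fun i => UnitSphere.base (d i)) i P := rfl

theorem bouquetToPi_inl :
    bouquetToPi d (Quot.mk _ (Sum.inl ())) = fun i => UnitSphere.base (d i) := rfl

theorem continuous_bouquetToPi : Continuous (bouquetToPi d) := by
  classical
  refine continuous_quot_lift _ (continuous_const.sumElim (continuous_sigma fun i => ?_))
  exact continuous_const.update i continuous_id

theorem bouquet_base_eq (i : ι) :
    (Quot.mk _ (Sum.inr ⟨i, UnitSphere.base (d i)⟩) : Bouquet d) = Quot.mk _ (Sum.inl ()) :=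
  (Quot.sound (BouquetRel.glue i)).symm

theorem bouquetToPi_injective : Function.Injective (bouquetToPi d) := by
  classical
  have h1 : ∀ i (P : UnitSphere (d i)),
      Function.update (fun i => UnitSphere.base (d i)) i P = (fun i => UnitSphere.base (d i)) →
        (Quot.mk _ (Sum.inr ⟨i, P⟩) : Bouquet d) = Quot.mk _ (Sum.inl ()) := by
    intro i P h
    have := congrFun h i
    rw [Function.update_self] at this
    rw [this, bouquet_base_eq]
  rintro ⟨⟨⟩ | ⟨i, P⟩⟩ ⟨⟨⟩ | ⟨j, Q⟩⟩ h
  · rfl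
  · exact (h1 j Q h.symm).symm
  · exact h1 i P h
  · have h : Function.update (fun i => UnitSphere.base (d i)) i P =
      Function.update (fun i => UnitSphere.base (d i)) j Q := h
    by_cases hij : i = j
    · subst hij
      rw [Function.update_injective _ i h]
    · have hi := congrFun h i
      have hj := congrFun h j
      rw [Function.update_self, Function.update_of_ne hij] at hi
      rw [Function.update_self, Function.update_of_ne (Ne.symm hij)] at hj
      rw [hi, ← hj]
      exact (bouquet_base_eq d i).trans (bouquet_base_eq d j).symm

instance : T2Space (Bouquet d) :=
  T2Space.of_injective_continuous (bouquetToPi_injective d) (continuous_bouquetToPi d)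

end BouquetTopology

section CollapseMap

variable {V : Type*} [DecidableEq V] {K : PreAbstractSimplicialComplex V} {a : V} {ι : Type*}
  {d : ι → ℕ} (e : ι ≃ coneCells K a) (vert : ∀ i, Fin (d i + 1) ≃ (e i).1)

open Classical in
/-- The map from the realization to the bouquet that collapses the cone to the base point. -/
noncomputable def collapseCone (x : V → ℝ) : Bouquet d :=
  if h : ∃ i, 0 < cellDepth (e i).1 x then
    Quot.mk _ (Sum.inr ⟨h.choose, cellToSphere (vert h.choose) x⟩)
  else Quot.mk _ (Sum.inl ())

theorem collapseCone_of_mem_coneOf {x : V → ℝ} (hx : x ∈ coneOf K a) :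
    collapseCone e vert x = Quot.mk _ (Sum.inl ()) :=
  dif_neg fun ⟨i, hi⟩ => hi.ne' (hx.2 _ (e i).2)

theorem collapseCone_of_mem_faceSimplex (hK : IsAlmostCone K a) {i : ι} {x : V → ℝ}
    (hx : x ∈ faceSimplex (e i).1) :
    collapseCone e vert x = Quot.mk _ (Sum.inr ⟨i, cellToSphere (vert i) x⟩) := by
  have hne : ∀ j, 0 < cellDepth (e j).1 x → j = i := fun j hj => by
    by_contra hji
    refine hj.ne' (hK.cellDepth_eq_zero_of_ne (e i).2 (e j).2 hx fun h => hji ?_)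
    exact e.injective (Subtype.ext h)
  by_cases h : ∃ j, 0 < cellDepth (e j).1 x
  · rw [collapseCone, dif_pos h]
    have hi := hne _ h.choose_spec
    rw [hi]
  · rw [collapseCone, dif_neg h, cellToSphere_of_cellDepth_eq_zero, bouquet_base_eq]
    exact le_antisymm (not_lt.1 fun hi => h ⟨i, hi⟩) (cellDepth_nonneg _ hx.1)

theorem exists_mem_faceSimplex_of_notMem_coneOf (hK : IsAlmostCone K a) {x : V → ℝ}
    (hx : x ∈ geometricRealization K) (hxC : x ∉ coneOf K a) :
    ∃ i, x ∈ faceSimplex (e i).1 ∧ 0 < cellDepth (e i).1 x := by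
  obtain ⟨F, hF, h⟩ := (mem_coneOf_or_exists_mem_coneCells hx).resolve_left hxC
  obtain ⟨i, hi⟩ := e.surjective ⟨F, hF⟩
  exact ⟨i, by rw [hi]; exact hK.mem_faceSimplex_of_cellDepth_pos hF hx h, by rw [hi]; exact h⟩

theorem continuous_collapseCone [Finite ι] (hK : IsAlmostCone K a) :
    Continuous fun x : geometricRealization K => collapseCone e vert x := by
  -- a finite closed cover, consisting of the cone and the simplices outside of it
  let s : Option ι → Set (geometricRealization K) := fun o =>
    o.elim {x | ∀ i, cellDepth (e i).1 x = 0} fun i => {x | x.1 ∈ faceSimplex (e i).1}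
  refine (locallyFinite_of_finite s).continuous ?_ ?_ ?_
  · refine Set.eq_univ_of_forall fun x => Set.mem_iUnion.2 ?_
    by_cases hx : x.1 ∈ coneOf K a
    · exact ⟨none, fun i => hx.2 _ (e i).2⟩
    · obtain ⟨i, hi, -⟩ := exists_mem_faceSimplex_of_notMem_coneOf e hK x.2 hx
      exact ⟨some i, hi⟩
  · rintro (_ | i)
    · simp only [s, Option.elim, Set.ofPred_forall]
      exact isClosed_iInter fun i => isClosed_eq
        ((continuous_cellDepth _).comp continuous_subtype_val) continuous_const
    · exact (isClosed_faceSimplex _).preimage continuous_subtype_val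
  · rintro (_ | i)
    · refine (continuousOn_const (c := (Quot.mk _ (Sum.inl ()) : Bouquet d))).congr fun x hx =>
        collapseCone_of_mem_coneOf e vert ⟨x.2, fun F hF => ?_⟩
      obtain ⟨i, hi⟩ := e.surjective ⟨F, hF⟩
      have := hx i
      rwa [hi] at this
    · refine ContinuousOn.congr (f := fun x : geometricRealization K =>
        (Quot.mk _ (Sum.inr ⟨i, cellToSphere (vert i) x⟩) : Bouquet d)) ?_ fun x hx =>
        collapseCone_of_mem_faceSimplex e vert hK hx
      have h1 : Continuous fun P : UnitSphere (d i) =>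
          (Quot.mk _ (Sum.inr ⟨i, P⟩) : Bouquet d) :=
        continuous_quot_mk.comp (continuous_inr.comp continuous_sigmaMk)
      exact h1.comp_continuousOn ((continuousOn_cellToSphere (vert i)).comp
        continuous_subtype_val.continuousOn fun x hx => hx)

theorem collapseCone_surjective (hK : IsAlmostCone K a) (b : Bouquet d) :
    ∃ x ∈ geometricRealization K, collapseCone e vert x = b := by
  have hbase := collapseCone_of_mem_coneOf e vert hK.single_mem_coneOf
  obtain ⟨⟨⟩ | ⟨i, P⟩⟩ := b
  · exact ⟨_, hK.single_mem_coneOf.1, hbase⟩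
  · by_cases hP : P = UnitSphere.base (d i)
    · refine ⟨_, hK.single_mem_coneOf.1, hbase.trans ?_⟩
      rw [hP]
      exact (bouquet_base_eq d i).symm
    · obtain ⟨x, hx, hxP⟩ := exists_cellToSphere_eq (vert i) hP
      refine ⟨x, ⟨_, (e i).2.1, hx⟩, ?_⟩
      rw [collapseCone_of_mem_faceSimplex e vert hK hx, hxP]

theorem collapseCone_eq (hK : IsAlmostCone K a) {x y : V → ℝ} (hx : x ∈ geometricRealization K)
    (hy : y ∈ geometricRealization K) (h : collapseCone e vert x = collapseCone e vert y) :
    x = y ∨ x ∈ coneOf K a ∧ y ∈ coneOf K a := by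
  classical
  have key : ∀ x y, x ∈ geometricRealization K → y ∈ geometricRealization K →
      collapseCone e vert x = collapseCone e vert y → x ∉ coneOf K a → x = y := by
    intro x y hx hy h hxC
    obtain ⟨i, hi, hi0⟩ := exists_mem_faceSimplex_of_notMem_coneOf e hK hx hxC
    have hb := cellToSphere_ne_base (vert i) hi0
    rw [collapseCone_of_mem_faceSimplex e vert hK hi] at h
    have h1 := congrFun (congrArg (bouquetToPi d) h) i
    rw [bouquetToPi_inr, Function.update_self] at h1
    by_cases hyC : y ∈ coneOf K a
    · rw [collapseCone_of_mem_coneOf e vert hyC, bouquetToPi_inl] at h1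
      exact absurd h1 hb
    · obtain ⟨j, hj, hj0⟩ := exists_mem_faceSimplex_of_notMem_coneOf e hK hy hyC
      rw [collapseCone_of_mem_faceSimplex e vert hK hj, bouquetToPi_inr] at h1
      by_cases hij : i = j
      · subst hij
        rw [Function.update_self] at h1
        exact cellToSphere_injective (vert i) hi hj hi0 hj0 h1
      · rw [Function.update_of_ne hij] at h1
        exact absurd h1 hb
  by_cases hxC : x ∈ coneOf K a
  · by_cases hyC : y ∈ coneOf K a
    · exact Or.inr ⟨hxC, hyC⟩
    · exact Or.inl (key y x hy hx h.symm hyC).symm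
  · exact Or.inl (key x y hx hy h hxC)

end CollapseMap

section Deformation

open scoped unitInterval

variable {V : Type*} [DecidableEq V] {K : PreAbstractSimplicialComplex V} {a : V} 

theorem min_cellDepth_of_mem_faceSimplex {ι : Type*} (e : ι ≃ coneCells K a)
    (hK : IsAlmostCone K a) {s : ℝ} (hs : 0 ≤ s) {i j : ι}
    {x : V → ℝ} (hx : x ∈ faceSimplex (e i).1) (hji : j ≠ i) :
    min (cellDepth (e j).1 x) (s / 2) = 0 := by
  rw [hK.cellDepth_eq_zero_of_ne (e i).2 (e j).2 hx fun h => hji (e.injective (Subtype.ext h)),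
    min_eq_left (by positivity)]

variable {ι : Type*} [Fintype ι] (e : ι ≃ coneCells K a)

/-- The total depth which the deformation takes away at time `s`. At most one summand is
nonzero. -/
noncomputable def pushTotal (s : ℝ) (x : V → ℝ) : ℝ := ∑ i, min (cellDepth (e i).1 x) (s / 2)

/-- An extension of the contraction of the cone to its apex: at time `s` the points of
a simplex outside the cone of depth at least `s / 2` are spread over the whole simplex, while the
points of smaller depth are pushed to the boundary and then on towards the apex. -/
noncomputable def coneDeformation (s : ℝ) (x : V → ℝ) : V → ℝ :=
  (1 - s + 2 * pushTotal e s x) • ((1 - pushTotal e s x)⁻¹ •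
    (x - ∑ i, (min (cellDepth (e i).1 x) (s / 2) / (e i).1.card) •
      ((e i).1 : Set V).indicator 1)) +
  (s - 2 * pushTotal e s x) • Pi.single a 1

theorem coneDeformation_of_mem_coneOf {s : ℝ} (hs : 0 ≤ s) {x : V → ℝ} (hx : x ∈ coneOf K a) :
    coneDeformation e s x = (1 - s) • x + s • Pi.single a 1 := by
  have h : ∀ i, min (cellDepth (e i).1 x) (s / 2) = 0 := fun i => by
    rw [hx.2 _ (e i).2, min_eq_left (by positivity)]
  simp [coneDeformation, pushTotal, h]

theorem pushTotal_of_mem_faceSimplex (hK : IsAlmostCone K a) {s : ℝ} (hs : 0 ≤ s) {i : ι}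
    {x : V → ℝ} (hx : x ∈ faceSimplex (e i).1) :
    pushTotal e s x = min (cellDepth (e i).1 x) (s / 2) :=
  Finset.sum_eq_single_of_mem i (Finset.mem_univ i) fun _ _ hji =>
    min_cellDepth_of_mem_faceSimplex e hK hs hx hji

theorem coneDeformation_of_mem_faceSimplex (hK : IsAlmostCone K a) {s : ℝ} (hs : 0 ≤ s) {i : ι}
    {x : V → ℝ} (hx : x ∈ faceSimplex (e i).1) :
    coneDeformation e s x = (1 - s + 2 * min (cellDepth (e i).1 x) (s / 2)) •
      cellPush (e i).1 (min (cellDepth (e i).1 x) (s / 2)) x +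
      (s - 2 * min (cellDepth (e i).1 x) (s / 2)) • Pi.single a 1 := by
  rw [coneDeformation, pushTotal_of_mem_faceSimplex e hK hs hx, cellPush,
    Finset.sum_eq_single_of_mem i (Finset.mem_univ i)]
  intro j _ hji
  rw [min_cellDepth_of_mem_faceSimplex e hK hs hx hji, zero_div, zero_smul]

theorem pushTotal_le_half (hK : IsAlmostCone K a) {s : ℝ} (hs : 0 ≤ s) (hs1 : s ≤ 1) {x : V → ℝ}
    (hx : x ∈ geometricRealization K) : pushTotal e s x ≤ 1 / 2 := by
  by_cases hxC : x ∈ coneOf K a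
  · rw [pushTotal, Finset.sum_eq_zero fun i _ => ?_]
    · norm_num
    · rw [hxC.2 _ (e i).2, min_eq_left (by positivity)]
  · obtain ⟨i, hi, -⟩ := exists_mem_faceSimplex_of_notMem_coneOf e hK hx hxC
    rw [pushTotal_of_mem_faceSimplex e hK hs hi]
    exact (min_le_right _ _).trans (by linarith)

theorem segment_apex_mem_coneOf (hK : IsAlmostCone K a) {s : ℝ} (hs : 0 ≤ s) (hs1 : s ≤ 1)
    {x : V → ℝ} (hx : x ∈ coneOf K a) : (1 - s) • x + s • Pi.single a 1 ∈ coneOf K a := by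
  obtain ⟨G, hG, haG, hxG⟩ := hK.mem_coneOf_iff.1 hx
  exact hK.mem_coneOf_iff.2 ⟨G, hG, haG, convex_faceSimplex G hxG (single_mem_faceSimplex haG)
    (by linarith) hs (by ring)⟩

theorem coneDeformation_mem (hK : IsAlmostCone K a) {s : ℝ} (hs : 0 ≤ s) (hs1 : s ≤ 1) {x : V → ℝ}
    (hx : x ∈ geometricRealization K) : coneDeformation e s x ∈ geometricRealization K := by
  by_cases hxC : x ∈ coneOf K a
  · rw [coneDeformation_of_mem_coneOf e hs hxC]
    exact (segment_apex_mem_coneOf hK hs hs1 hxC).1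
  · obtain ⟨i, hi, hi0⟩ := exists_mem_faceSimplex_of_notMem_coneOf e hK hx hxC
    have hF := face_nonempty (e i).2.1
    rw [coneDeformation_of_mem_faceSimplex e hK hs hi]
    rcases le_or_gt (s / 2) (cellDepth (e i).1 x) with h | h
    · rw [min_eq_right h, mul_div_cancel₀ _ two_ne_zero, sub_add_cancel, sub_self, zero_smul,
        one_smul, add_zero]
      exact ⟨_, (e i).2.1, cellPush_mem_faceSimplex hF hi h (by linarith)⟩
    · rw [min_eq_left h.le]
      obtain ⟨v, hv, hmem⟩ := exists_cellPush_mem_faceSimplex_erase hF hi (by linarith)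
      exact ⟨_, hK.insert_erase_mem _ (e i).2.1 (e i).2.2 v hv,
        convex_faceSimplex _ (faceSimplex_mono (Finset.subset_insert _ _) hmem)
          (single_mem_faceSimplex (Finset.mem_insert_self _ _)) (by linarith) (by linarith)
          (by ring)⟩

theorem coneDeformation_zero (hK : IsAlmostCone K a) {x : V → ℝ}
    (hx : x ∈ geometricRealization K) : coneDeformation e 0 x = x := by
  by_cases hxC : x ∈ coneOf K a
  · rw [coneDeformation_of_mem_coneOf e le_rfl hxC]
    simp
  · obtain ⟨i, hi, hi0⟩ := exists_mem_faceSimplex_of_notMem_coneOf e hK hx hxC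
    rw [coneDeformation_of_mem_faceSimplex e hK le_rfl hi, zero_div, min_eq_right hi0.le,
      cellPush_zero]
    simp

theorem continuous_coneDeformation (hK : IsAlmostCone K a) :
    Continuous fun p : I × geometricRealization K => coneDeformation e p.1 p.2 := by
  have hmin : ∀ i, Continuous fun p : I × geometricRealization K =>
      min (cellDepth (e i).1 p.2) ((p.1 : ℝ) / 2) := fun i =>
    ((continuous_cellDepth _).comp (continuous_subtype_val.comp continuous_snd)).min
      ((continuous_subtype_val.comp continuous_fst).div_const 2)
  have htot : Continuous fun p : I × geometricRealization K => pushTotal e p.1 p.2 :=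
    continuous_finsetSum _ fun i _ => hmin i
  have hs : Continuous fun p : I × geometricRealization K => (p.1 : ℝ) :=
    continuous_subtype_val.comp continuous_fst
  unfold coneDeformation
  refine Continuous.add (Continuous.smul
    ((continuous_const.sub hs).add (htot.const_mul 2)) (Continuous.smul (Continuous.inv₀
    (continuous_const.sub htot) fun p => ?_) (Continuous.sub ?_
    (continuous_finsetSum _ fun i _ => ?_))))
    (Continuous.smul (hs.sub (htot.const_mul 2)) continuous_const)
  · have := pushTotal_le_half e hK p.1.2.1 p.1.2.2 p.2.2
    exact (by linarith : 0 < 1 - pushTotal e p.1 p.2).ne'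
  · exact continuous_subtype_val.comp continuous_snd
  · exact Continuous.smul ((hmin i).div_const _) continuous_const

end Deformation

/-- The realization of a finite almost cone is homotopy equivalent to a bouquet of spheres, with
one sphere for every face outside the cone. -/
theorem nonempty_homotopyEquiv_bouquet {V : Type*} [DecidableEq V]
    {K : PreAbstractSimplicialComplex V} {a : V} (hK : IsAlmostCone K a) (hfin : K.faces.Finite)
    {ι : Type*} {d : ι → ℕ} (e : ι ≃ coneCells K a) (hd : ∀ i, (e i).1.card = d i + 1) :
    Nonempty (geometricRealization K ≃ₕ Bouquet d) := by
  have hcells : Finite (coneCells K a) := (hfin.subset fun F hF => hF.1).to_subtype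
  have hι : Finite ι := Finite.of_equiv _ e.symm
  have := Fintype.ofFinite ι
  let vert : ∀ i, Fin (d i + 1) ≃ (e i).1 := fun i => ((e i).1.equivFinOfCardEq (hd i)).symm
  have : CompactSpace (geometricRealization K) :=
    isCompact_iff_compactSpace.1 (isCompact_geometricRealization hfin)
  have hfib : ∀ x y : geometricRealization K, collapseCone e vert x = collapseCone e vert y →
      x = y ∨ x.1 ∈ coneOf K a ∧ y.1 ∈ coneOf K a := fun x y h =>
    (collapseCone_eq e vert hK x.2 y.2 h).imp_left Subtype.ext
  refine nonempty_homotopyEquiv_of_collapse ⟨_, continuous_collapseCone e vert hK⟩ (fun b => ?_)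
    ⟨fun p => ⟨coneDeformation e p.1 p.2, coneDeformation_mem e hK p.1.2.1 p.1.2.2 p.2.2⟩,
      (continuous_coneDeformation e hK).subtype_mk _⟩ (fun x => ?_) (fun x y h => ?_)
    (fun s x y h => ?_)
  · obtain ⟨x, hx, hxb⟩ := collapseCone_surjective e vert hK b
    exact ⟨⟨x, hx⟩, hxb⟩
  · exact Subtype.ext (coneDeformation_zero e hK x.2)
  · rcases hfib x y h with rfl | ⟨hx, hy⟩
    · rfl
    · refine Subtype.ext ?_
      change coneDeformation e ((1 : unitInterval) : ℝ) x =
        coneDeformation e ((1 : unitInterval) : ℝ) y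
      rw [Set.Icc.coe_one, coneDeformation_of_mem_coneOf e zero_le_one hx,
        coneDeformation_of_mem_coneOf e zero_le_one hy]
      simp
  · rcases hfib x y h with rfl | ⟨hx, hy⟩
    · rfl
    · have hC : ∀ z ∈ coneOf K a, collapseCone e vert (coneDeformation e s z) =
          Quot.mk _ (Sum.inl ()) := fun z hz => by
        refine collapseCone_of_mem_coneOf e vert ?_
        rw [coneDeformation_of_mem_coneOf e s.2.1 hz]
        exact segment_apex_mem_coneOf hK s.2.1 s.2.2 hz
      exact (hC x hx).trans (hC y hy).symm

/-! ### Connected components of an almost cone -/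

section Components

variable {V : Type*} [DecidableEq V] {K : PreAbstractSimplicialComplex V} {a : V}

/-- The part of the realization which contains the cone: all points except for the isolated
vertices, which are the faces of cardinality `1` outside the cone. -/
def mainPart (K : PreAbstractSimplicialComplex V) (a : V) : Set (V → ℝ) :=
  {x | x ∈ geometricRealization K ∧ ∀ F ∈ coneCells K a, F.card = 1 → cellDepth F x = 0}

theorem coneOf_subset_mainPart : coneOf K a ⊆ mainPart K a :=
  fun _ hx => ⟨hx.1, fun F hF _ => hx.2 F hF⟩

theorem IsAlmostCone.faceSimplex_subset_mainPart (hK : IsAlmostCone K a) {F : Finset V}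
    (hF : F ∈ coneCells K a) (hcard : F.card ≠ 1) : faceSimplex F ⊆ mainPart K a :=
  fun _ hx => ⟨⟨F, hF.1, hx⟩, fun _ hG hG1 =>
    hK.cellDepth_eq_zero_of_ne hF hG hx fun h => hcard (h ▸ hG1)⟩

theorem IsAlmostCone.mem_mainPart_cases (hK : IsAlmostCone K a) {x : V → ℝ}
    (hx : x ∈ mainPart K a) : x ∈ coneOf K a ∨
      ∃ F ∈ coneCells K a, 2 ≤ F.card ∧ x ∈ faceSimplex F ∧ 0 < cellDepth F x := by
  refine (mem_coneOf_or_exists_mem_coneCells hx.1).imp_right ?_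
  rintro ⟨F, hF, h⟩
  have h0 := (face_nonempty hF.1).card_pos
  have h1 : F.card ≠ 1 := fun h1 => h.ne' (hx.2 F hF h1)
  exact ⟨F, hF, by omega, hK.mem_faceSimplex_of_cellDepth_pos hF hx.1 h, h⟩

theorem IsAlmostCone.starConvex_coneOf (hK : IsAlmostCone K a) :
    StarConvex ℝ (Pi.single a 1) (coneOf K a) := by
  intro x hx s t hs ht hst
  obtain rfl : t = 1 - s := by linarith
  rw [add_comm]
  exact segment_apex_mem_coneOf hK hs (by linarith) hx

theorem IsAlmostCone.single_mem_coneOf_of_mem (hK : IsAlmostCone K a) {F : Finset V}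
    (hF : F ∈ coneCells K a) (hcard : 2 ≤ F.card) {v : V} (hv : v ∈ F) :
    Pi.single v 1 ∈ coneOf K a := by
  obtain ⟨u, hu, huv⟩ := Finset.exists_mem_ne (by omega : 1 < F.card) v
  exact hK.mem_coneOf_iff.2 ⟨_, hK.insert_erase_mem F hF.1 hF.2 u hu, Finset.mem_insert_self _ _,
    single_mem_faceSimplex (Finset.mem_insert_of_mem (Finset.mem_erase.2 ⟨huv.symm, hv⟩))⟩

theorem IsAlmostCone.isPathConnected_mainPart (hK : IsAlmostCone K a) :
    IsPathConnected (mainPart K a) := by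
  have hcone : ∀ x ∈ coneOf K a, JoinedIn (mainPart K a) (Pi.single a 1) x := fun x hx =>
    JoinedIn.of_segment_subset
      ((hK.starConvex_coneOf.segment_subset hx).trans coneOf_subset_mainPart)
  refine ⟨_, coneOf_subset_mainPart hK.single_mem_coneOf, fun {x} hx => ?_⟩
  rcases hK.mem_mainPart_cases hx with hxC | ⟨F, hF, hcard, hxF, -⟩
  · exact hcone x hxC
  · obtain ⟨v, hv⟩ := face_nonempty hF.1
    refine (hcone _ (hK.single_mem_coneOf_of_mem hF hcard hv)).trans (JoinedIn.of_segment_subset ?_)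
    exact ((convex_faceSimplex F).segment_subset (single_mem_faceSimplex hv) hxF).trans
      (hK.faceSimplex_subset_mainPart hF (by omega))

theorem cellDepth_singleton {V : Type*} (v : V) (x : V → ℝ) : cellDepth {v} x = x v := by
  simp [cellDepth]

/-- A point of a zero-dimensional simplex. -/
theorem eq_single_of_mem_faceSimplex_singleton {v : V} {x : V → ℝ} (hx : x ∈ faceSimplex {v}) :
    x = Pi.single v 1 := by
  have h1 : x v = 1 := by simpa using hx.2.2
  funext u
  by_cases huv : u = v
  · rw [huv, h1, Pi.single_eq_same]
  · rw [hx.2.1 u (by simpa using huv), Pi.single_eq_of_ne huv]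

/-- An isolated vertex is clopen: the barycentric coordinate at this vertex takes no other values
than `0` and `1`. -/
theorem IsAlmostCone.isClopen_cellDepth_pos (hK : IsAlmostCone K a) {F : Finset V}
    (hF : F ∈ coneCells K a) (hcard : F.card = 1) :
    IsClopen {x : geometricRealization K | 0 < cellDepth F x} := by
  have hcont : Continuous fun x : geometricRealization K => cellDepth F x :=
    (continuous_cellDepth F).comp continuous_subtype_val
  refine ⟨?_, isOpen_lt continuous_const hcont⟩
  have heq : {x : geometricRealization K | 0 < cellDepth F x} =
      {x : geometricRealization K | 1 ≤ cellDepth F x} := by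
    ext x
    refine ⟨fun h => ?_, fun h => lt_of_lt_of_le (zero_lt_one' ℝ) h⟩
    have hx := hK.mem_faceSimplex_of_cellDepth_pos hF x.2 h
    obtain ⟨v, rfl⟩ := Finset.card_eq_one.1 hcard
    have h1 : x.1 v = 1 := by simpa using hx.2.2
    exact (h1.symm.trans (cellDepth_singleton v x.1).symm).le
  rw [heq]
  exact isClosed_le continuous_const hcont

theorem IsAlmostCone.isClopen_mainPart (hK : IsAlmostCone K a) (hfin : K.faces.Finite) :
    IsClopen {x : geometricRealization K | x.1 ∈ mainPart K a} := by
  have heq : {x : geometricRealization K | x.1 ∈ mainPart K a} =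
      ⋂ F ∈ {F | F ∈ coneCells K a ∧ F.card = 1},
        {x : geometricRealization K | 0 < cellDepth F x}ᶜ := by
    ext x
    simp only [Set.mem_iInter, Set.mem_compl_iff]
    constructor
    · intro hx F hF h
      exact ne_of_gt h (hx.2 F hF.1 hF.2)
    · exact fun h => ⟨x.2, fun F hF h1 =>
        le_antisymm (not_lt.1 (h F ⟨hF, h1⟩)) (cellDepth_nonneg_of_mem F x.2)⟩
  rw [heq]
  exact Set.Finite.isClopen_biInter (hfin.subset fun F hF => hF.1.1) fun F hF =>
    (hK.isClopen_cellDepth_pos hF.1 hF.2).compl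

theorem coe_image_mainPart : Subtype.val '' {x : geometricRealization K | x.1 ∈ mainPart K a} =
    mainPart K a := by
  ext x
  exact ⟨fun ⟨y, hy, h⟩ => h ▸ hy, fun hx => ⟨⟨x, hx.1⟩, hx, rfl⟩⟩

theorem IsAlmostCone.connectedComponent_of_mem_mainPart (hK : IsAlmostCone K a)
    (hfin : K.faces.Finite) {x : geometricRealization K} (hx : x.1 ∈ mainPart K a) :
    connectedComponent x = {x : geometricRealization K | x.1 ∈ mainPart K a} := by
  refine Set.Subset.antisymm ((hK.isClopen_mainPart hfin).connectedComponent_subset hx)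
    (IsPreconnected.subset_connectedComponent ?_ hx)
  refine (Topology.IsInducing.subtypeVal.isPathConnected_iff.2 ?_).isConnected.isPreconnected
  rw [coe_image_mainPart]
  exact hK.isPathConnected_mainPart

theorem IsAlmostCone.connectedComponent_of_notMem_mainPart (hK : IsAlmostCone K a)
    {x : geometricRealization K} (hx : x.1 ∉ mainPart K a) : connectedComponent x = {x} := by
  obtain ⟨F, hF, hcard, h0⟩ : ∃ F ∈ coneCells K a, F.card = 1 ∧ 0 < cellDepth F x := by
    by_contra! h
    exact hx ⟨x.2, fun F hF h1 => le_antisymm (h F hF h1) (cellDepth_nonneg_of_mem F x.2)⟩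
  refine Set.Subset.antisymm (fun y hy => ?_) (Set.singleton_subset_iff.2 mem_connectedComponent)
  have hy0 := (hK.isClopen_cellDepth_pos hF hcard).connectedComponent_subset h0 hy
  obtain ⟨v, rfl⟩ := Finset.card_eq_one.1 hcard
  refine Subtype.ext ?_
  rw [eq_single_of_mem_faceSimplex_singleton (hK.mem_faceSimplex_of_cellDepth_pos hF x.2 h0),
    eq_single_of_mem_faceSimplex_singleton (hK.mem_faceSimplex_of_cellDepth_pos hF y.2 hy0)]

theorem IsAlmostCone.connectedSpace_iff (hK : IsAlmostCone K a) :
    ConnectedSpace (geometricRealization K) ↔ ∀ F ∈ coneCells K a, F.card ≠ 1 := by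
  constructor
  · intro _ F hF hcard
    obtain ⟨v, rfl⟩ := Finset.card_eq_one.1 hcard
    have hclopen := hK.isClopen_cellDepth_pos hF hcard
    rcases isClopen_iff.1 hclopen with h | h
    · have hv : (⟨Pi.single v 1, _, hF.1, single_mem_faceSimplex (Finset.mem_singleton_self v)⟩ :
          geometricRealization K) ∈ {x : geometricRealization K | 0 < cellDepth {v} x} := by
        change 0 < cellDepth {v} (Pi.single v 1)
        rw [cellDepth_singleton, Pi.single_eq_same]
        exact zero_lt_one
      rw [h] at hv
      exact hv
    · have ha : (⟨_, hK.single_mem_coneOf.1⟩ : geometricRealization K) ∈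
          {x : geometricRealization K | 0 < cellDepth {v} x} := h ▸ Set.mem_univ _
      exact ne_of_gt ha (hK.single_mem_coneOf.2 _ hF)
  · intro h
    have heq : mainPart K a = geometricRealization K :=
      Set.Subset.antisymm (fun x hx => hx.1) fun x hx =>
        ⟨hx, fun F hF h1 => absurd h1 (h F hF)⟩
    have hc := hK.isPathConnected_mainPart.isConnected
    rw [heq] at hc
    exact isConnected_iff_connectedSpace.1 hc

theorem IsAlmostCone.hasNonSimplyConnectedComponent_iff (hK : IsAlmostCone K a)
    (hfin : K.faces.Finite) :
    HasNonSimplyConnectedComponent (geometricRealization K) ↔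
      ¬ IsSimplyConnected (mainPart K a) := by
  have hmain : ∀ x : geometricRealization K, x.1 ∈ mainPart K a →
      (IsSimplyConnected (connectedComponent x) ↔ IsSimplyConnected (mainPart K a)) := by
    intro x hx
    rw [hK.connectedComponent_of_mem_mainPart hfin hx,
      ← Topology.IsEmbedding.subtypeVal.isSimplyConnected_image, coe_image_mainPart]
  constructor
  · rintro ⟨x, hx⟩ hsc
    by_cases hxm : x.1 ∈ mainPart K a
    · exact hx ((hmain x hxm).2 hsc)
    · rw [hK.connectedComponent_of_notMem_mainPart hxm] at hx
      exact hx (inferInstanceAs (SimplyConnectedSpace ({x} : Set (geometricRealization K))))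
  · intro h
    have ha := hK.single_mem_coneOf
    exact ⟨⟨_, ha.1⟩, fun hsc => h ((hmain _ (coneOf_subset_mainPart ha)).1 hsc)⟩

end Components

/-! ### Simple connectedness of an almost cone -/

section StraightLines

/-- A set is contractible, and hence simply connected, if its points can be moved within the set
along segments, first to their images under `f` and from there to the point `c`. -/
theorem isSimplyConnected_of_segment_subset {E : Type*} [AddCommGroup E] [Module ℝ E]
    [TopologicalSpace E] [IsTopologicalAddGroup E] [ContinuousSMul ℝ E] {s : Set E} {f : E → E}
    {c : E} (hne : s.Nonempty) (hf : ContinuousOn f s) (h1 : ∀ x ∈ s, segment ℝ x (f x) ⊆ s)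
    (h2 : ∀ x ∈ s, segment ℝ (f x) c ⊆ s) : IsSimplyConnected s := by
  obtain ⟨x₀, hx₀⟩ := hne
  have hfs : ∀ x ∈ s, f x ∈ s := fun x hx => h1 x hx (right_mem_segment ℝ _ _)
  have hcs : c ∈ s := h2 x₀ hx₀ (right_mem_segment ℝ _ _)
  let g : C(s, s) := ⟨fun x => ⟨f x, hfs x x.2⟩, hf.domRestrict.subtype_mk _⟩
  have key : ∀ k l : C(s, s), (∀ x, segment ℝ (k x : E) (l x) ⊆ s) → k.Homotopic l := by
    intro k l hkl
    refine ⟨⟨⟨fun p => ⟨(1 - (p.1 : ℝ)) • (k p.2 : E) + (p.1 : ℝ) • (l p.2 : E),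
      hkl p.2 ⟨1 - p.1, p.1, by linarith [p.1.2.2], p.1.2.1, by ring, rfl⟩⟩, ?_⟩, fun x => ?_,
      fun x => ?_⟩⟩
    · fun_prop
    · exact Subtype.ext (by simp)
    · exact Subtype.ext (by simp)
  have hcontr : ContractibleSpace s := (contractible_iff_id_nullhomotopic s).2
    ⟨⟨c, hcs⟩, (key (ContinuousMap.id s) g fun x => h1 x x.2).trans
      (key g (ContinuousMap.const s ⟨c, hcs⟩) fun x => h2 x x.2)⟩
  exact SimplyConnectedSpace.ofContractible s

theorem isSimplyConnected_openSimplex {V : Type*} {F : Finset V} (hF : F.Nonempty) :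
    IsSimplyConnected {x ∈ faceSimplex F | 0 < cellDepth F x} := by
  have hconv : Convex ℝ {x ∈ faceSimplex F | 0 < cellDepth F x} := by
    intro x hx y hy s t hs ht hst
    refine ⟨convex_faceSimplex F hx.1 hy.1 hs ht hst, cellDepth_pos hF fun v hv => ?_⟩
    exact (convex_Ioi (0 : ℝ)) (pos_of_cellDepth_pos hx.2 hv) (pos_of_cellDepth_pos hy.2 hv)
      hs ht hst
  have hne : {x ∈ faceSimplex F | 0 < cellDepth F x}.Nonempty := by
    have h0 : ∑ v ∈ F, (0 : V → ℝ) v = 0 := by simp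
    refine ⟨_, cellPoint_mem_faceSimplex hF h0, ?_⟩
    rw [cellDepth_cellPoint hF h0]
    exact inv_pos.2 (by linarith [cellDepth_nonpos_of_sum_eq_zero h0])
  have := hconv.contractibleSpace hne
  exact SimplyConnectedSpace.ofContractible _

/-- An open simplex of dimension at least two stays path connected when its barycentre is
removed: it is parametrized by the directions from the barycentre. -/
theorem isPathConnected_punctured_openSimplex {V : Type*} {F : Finset V} (hcard : 3 ≤ F.card) :
    IsPathConnected {x ∈ faceSimplex F | 0 < cellDepth F x ∧ cellDepth F x < 1} := by
  obtain ⟨n, hn⟩ : ∃ n, F.card = n + 1 := ⟨F.card - 1, by omega⟩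
  let vert : Fin (n + 1) ≃ F := (F.equivFinOfCardEq hn).symm
  have hF := nonempty_of_equiv_fin vert
  have hc : (0 : ℝ) < F.card := Nat.cast_pos.2 hF.card_pos
  have hpc : IsPathConnected ({0}ᶜ : Set (Fin n → ℝ)) := by
    refine isPathConnected_compl_singleton_of_one_lt_rank ?_ 0
    rw [rank_fin_fun]
    exact_mod_cast (by omega : 1 < n)
  have himg : {x ∈ faceSimplex F | 0 < cellDepth F x ∧ cellDepth F x < 1} =
      (fun c => cellPoint F (zeroSumVector vert c)) '' {0}ᶜ := by
    ext x
    constructor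
    · rintro ⟨hx, h0, h1⟩
      refine ⟨fun j => cellDirection F x (vert j.succ), fun hzero => h1.ne ?_, ?_⟩
      · have hall := eq_of_sum_eq_zero vert (sum_cellDirection hF hx) (w' := fun _ => 0) (by simp)
          fun j => congrFun hzero j
        have hd := cellDepth_congr hall
        obtain ⟨v, -, hv⟩ := exists_cellDepth_eq hF fun _ : V => (0 : ℝ)
        rw [hv, mul_zero, cellDepth_cellDirection hF h0, sub_eq_zero, eq_comm, inv_eq_one] at hd
        exact hd
      · have hw : ∀ v ∈ F, zeroSumVector vert (fun j => cellDirection F x (vert j.succ)) v =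
            cellDirection F x v :=
          eq_of_sum_eq_zero vert (sum_zeroSumVector vert _) (sum_cellDirection hF hx) fun j => by
            rw [zeroSumVector_apply, Fin.cons_succ]
        change cellPoint F _ = x
        rw [cellPoint_congr hw, cellPoint_cellDirection hF hx h0]
    · rintro ⟨c, hc0, rfl⟩
      have hw := sum_zeroSumVector vert c
      have hd : cellDepth F (zeroSumVector vert c) < 0 := by
        refine (cellDepth_nonpos_of_sum_eq_zero hw).lt_of_ne fun hd => hc0 ?_
        -- otherwise all coordinates are nonnegative, with sum zero
        have hnn : ∀ v ∈ F, 0 ≤ zeroSumVector vert c v := fun v hv =>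
          nonneg_of_mul_nonneg_right (hd.ge.trans (cellDepth_le hv _)) hc
        have hz := (Finset.sum_eq_zero_iff_of_nonneg hnn).1 hw
        funext j
        have := hz _ (vert j.succ).2
        rwa [zeroSumVector_apply, Fin.cons_succ] at this
      refine ⟨cellPoint_mem_faceSimplex hF hw, ?_⟩
      rw [cellDepth_cellPoint hF hw]
      exact ⟨inv_pos.2 (by linarith), inv_lt_one_of_one_lt₀ (by linarith)⟩
  rw [himg]
  exact hpc.image' ((continuousOn_cellPoint F).comp (continuous_zeroSumVector vert).continuousOn
    fun c _ => sum_zeroSumVector vert c)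

end StraightLines

section PuncturedMainPart

variable {V : Type*} [DecidableEq V] {K : PreAbstractSimplicialComplex V} {a : V}

theorem IsAlmostCone.segment_subset_of_mem_faceSimplex (hK : IsAlmostCone K a) {F : Finset V}
    (hF : F ∈ coneCells K a) (hcard : F.card ≠ 1) {x y : V → ℝ} (hx : x ∈ faceSimplex F)
    (hy : y ∈ faceSimplex F) (h : ∀ s : ℝ, 0 ≤ s → cellDepth F ((1 - s) • x + s • y) < 1) :
    segment ℝ x y ⊆ {x ∈ mainPart K a | ∀ F ∈ coneCells K a, cellDepth F x < 1} := by
  rintro _ ⟨t, s, ht, hs, hst, rfl⟩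
  have hmem := convex_faceSimplex F hx hy ht hs hst
  refine ⟨hK.faceSimplex_subset_mainPart hF hcard hmem, fun G hG => ?_⟩
  by_cases hGF : G = F
  · obtain rfl : t = 1 - s := by linarith
    rw [hGF]
    exact h s hs
  · rw [hK.cellDepth_eq_zero_of_ne hF hG hmem hGF]
    exact zero_lt_one

/-- Without the barycentres of the simplices outside the cone, the main part of the realization
can be pushed into the cone and is thus contractible. -/
theorem IsAlmostCone.isSimplyConnected_punctured (hK : IsAlmostCone K a) (hfin : K.faces.Finite) :
    IsSimplyConnected {x ∈ mainPart K a | ∀ F ∈ coneCells K a, cellDepth F x < 1} := by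
  have hcells : Finite (coneCells K a) := (hfin.subset fun F hF => hF.1).to_subtype
  have := Fintype.ofFinite (coneCells K a)
  have hcone : coneOf K a ⊆ {x ∈ mainPart K a | ∀ F ∈ coneCells K a, cellDepth F x < 1} :=
    fun x hx => ⟨coneOf_subset_mainPart hx, fun F hF => by rw [hx.2 F hF]; exact zero_lt_one⟩
  let f : (V → ℝ) → V → ℝ := fun x => (1 - ∑ i : coneCells K a, cellDepth i.1 x)⁻¹ •
    (x - ∑ i : coneCells K a, (cellDepth i.1 x / i.1.card) • (i.1 : Set V).indicator 1)
  have f_cone : ∀ x ∈ coneOf K a, f x = x := by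
    intro x hx
    have h : ∀ i : coneCells K a, cellDepth i.1 x = 0 := fun i => hx.2 _ i.2
    simp [f, h]
  have sum_cell : ∀ F (hF : F ∈ coneCells K a), ∀ x ∈ faceSimplex F,
      ∑ i : coneCells K a, cellDepth i.1 x = cellDepth F x := fun F hF x hx =>
    Finset.sum_eq_single_of_mem (⟨F, hF⟩ : coneCells K a) (Finset.mem_univ _) fun j _ hj =>
      hK.cellDepth_eq_zero_of_ne hF j.2 hx fun h => hj (Subtype.ext h)
  have f_cell : ∀ F ∈ coneCells K a, ∀ x ∈ faceSimplex F,
      f x = cellPush F (cellDepth F x) x := by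
    intro F hF x hx
    simp only [f]
    rw [sum_cell F hF x hx, cellPush, Finset.sum_eq_single_of_mem (⟨F, hF⟩ : coneCells K a)
      (Finset.mem_univ _)]
    intro j _ hj
    rw [hK.cellDepth_eq_zero_of_ne hF j.2 hx fun h => hj (Subtype.ext h), zero_div, zero_smul]
  refine isSimplyConnected_of_segment_subset (f := f) (c := Pi.single a 1)
    ⟨_, hcone hK.single_mem_coneOf⟩ ?_ ?_ ?_
  · refine ContinuousOn.smul (ContinuousOn.inv₀ (Continuous.continuousOn
      (continuous_const.sub (continuous_finsetSum _ fun i _ => continuous_cellDepth _)))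
      fun x hx => ?_) (Continuous.continuousOn (continuous_id.sub (continuous_finsetSum _
        fun i _ => ((continuous_cellDepth _).div_const _).smul continuous_const)))
    refine (sub_pos.2 ?_).ne'
    change ∑ i : coneCells K a, cellDepth i.1 x < 1
    rcases hK.mem_mainPart_cases hx.1 with hxC | ⟨F, hF, -, hxF, -⟩
    · rw [Finset.sum_eq_zero fun i _ => hxC.2 _ i.2]
      exact zero_lt_one
    · rw [sum_cell F hF x hxF]
      exact hx.2 F hF
  · intro x hx
    rcases hK.mem_mainPart_cases hx.1 with hxC | ⟨F, hF, hcard, hxF, -⟩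
    · rw [f_cone x hxC, segment_same]
      exact Set.singleton_subset_iff.2 hx
    · have hne := face_nonempty hF.1
      rw [f_cell F hF x hxF]
      exact hK.segment_subset_of_mem_faceSimplex hF (by omega) hxF
        (cellPush_mem_faceSimplex hne hxF le_rfl (hx.2 F hF)) fun s hs =>
        cellDepth_segment_lt_one hne (cellDepth_nonneg F hxF.1) le_rfl (hx.2 F hF) hs
  · intro x hx
    have hfx : f x ∈ coneOf K a := by
      rcases hK.mem_mainPart_cases hx.1 with hxC | ⟨F, hF, -, hxF, -⟩
      · rwa [f_cone x hxC]
      · obtain ⟨v, hv, h⟩ :=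
          exists_cellPush_mem_faceSimplex_erase (face_nonempty hF.1) hxF (hx.2 F hF)
        rw [f_cell F hF x hxF]
        exact hK.mem_coneOf_iff.2 ⟨_, hK.insert_erase_mem F hF.1 hF.2 v hv,
          Finset.mem_insert_self _ _, faceSimplex_mono (Finset.subset_insert _ _) h⟩
    rw [segment_symm]
    exact (hK.starConvex_coneOf.segment_subset hfx).trans hcone

/-- If there is no one-dimensional simplex outside the cone, van Kampen's theorem applies to
the complement of the barycentres and the open simplices outside the cone. -/
theorem IsAlmostCone.isSimplyConnected_mainPart (hK : IsAlmostCone K a) (hfin : K.faces.Finite)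
    (h2 : ∀ F ∈ coneCells K a, F.card ≠ 2) : IsSimplyConnected (mainPart K a) := by
  have hcont : ∀ F, Continuous fun x : mainPart K a => cellDepth F x.1 := fun F =>
    (continuous_cellDepth F).comp continuous_subtype_val
  have hU : Subtype.val '' {x : mainPart K a | ∀ F ∈ coneCells K a, cellDepth F x < 1} =
      {x ∈ mainPart K a | ∀ F ∈ coneCells K a, cellDepth F x < 1} := by
    ext x
    exact ⟨fun ⟨y, hy, h⟩ => h ▸ ⟨y.2, hy⟩, fun hx => ⟨⟨x, hx.1⟩, hx.2, rfl⟩⟩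
  let ι := {F // F ∈ coneCells K a ∧ 3 ≤ F.card}
  have hV : ∀ i : ι, Subtype.val '' {x : mainPart K a | 0 < cellDepth i.1 x} =
      {x ∈ faceSimplex i.1 | 0 < cellDepth i.1 x} := by
    intro i
    ext x
    constructor
    · rintro ⟨y, hy, rfl⟩
      exact ⟨hK.mem_faceSimplex_of_cellDepth_pos i.2.1 y.2.1 hy, hy⟩
    · intro hx
      have := i.2.2
      exact ⟨⟨x, hK.faceSimplex_subset_mainPart i.2.1 (by omega) hx.1⟩, hx.2, rfl⟩
  have hUV : ∀ i : ι, Subtype.val '' ({x : mainPart K a | ∀ F ∈ coneCells K a, cellDepth F x < 1} ∩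
      {x : mainPart K a | 0 < cellDepth i.1 x}) =
      {x ∈ faceSimplex i.1 | 0 < cellDepth i.1 x ∧ cellDepth i.1 x < 1} := by
    intro i
    ext x
    constructor
    · rintro ⟨y, ⟨hy1, hy0⟩, rfl⟩
      exact ⟨hK.mem_faceSimplex_of_cellDepth_pos i.2.1 y.2.1 hy0, hy0, hy1 _ i.2.1⟩
    · rintro ⟨hx, h0, h1⟩
      have hi := i.2.2
      refine ⟨⟨x, hK.faceSimplex_subset_mainPart i.2.1 (by omega) hx⟩, ⟨fun G hG => ?_, h0⟩, rfl⟩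
      change cellDepth G x < 1
      by_cases hGi : G = i.1
      · rwa [hGi]
      · rw [hK.cellDepth_eq_zero_of_ne i.2.1 hG hx hGi]
        exact zero_lt_one
  refine simplyConnectedSpace_of_open_cover
    {x : mainPart K a | ∀ F ∈ coneCells K a, cellDepth F x < 1}
    (fun i : ι => {x : mainPart K a | 0 < cellDepth i.1 x}) ?_ (fun i => ?_) (fun x => ?_)
    (fun i j x hi hj => ?_) ?_ (fun i => ?_) fun i => ?_
  · have heq : {x : mainPart K a | ∀ F ∈ coneCells K a, cellDepth F x < 1} =
        ⋂ F ∈ coneCells K a, {x : mainPart K a | cellDepth F x < 1} := by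
      ext x
      simp
    rw [heq]
    exact (hfin.subset fun F hF => hF.1).isOpen_biInter fun F _ =>
      isOpen_lt (hcont F) continuous_const
  · exact isOpen_lt continuous_const (hcont i.1)
  · rcases hK.mem_mainPart_cases x.2 with hxC | ⟨F, hF, hcard, hxF, h0⟩
    · exact Or.inl fun F hF => by rw [hxC.2 F hF]; exact zero_lt_one
    · have := h2 F hF
      exact Or.inr ⟨⟨F, hF, by omega⟩, h0⟩
  · exact Subtype.ext (hK.eq_of_cellDepth_pos j.2.1 i.2.1.1
      (hK.mem_faceSimplex_of_cellDepth_pos i.2.1 x.2.1 hi) hj)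
  · rw [← Topology.IsEmbedding.subtypeVal.isSimplyConnected_image, hU]
    exact hK.isSimplyConnected_punctured hfin
  · rw [← Topology.IsEmbedding.subtypeVal.isSimplyConnected_image, hV]
    exact isSimplyConnected_openSimplex (face_nonempty i.2.1.1)
  · rw [Topology.IsInducing.subtypeVal.isPathConnected_iff, hUV]
    exact isPathConnected_punctured_openSimplex i.2.2

end PuncturedMainPart

section EdgeLoop

open scoped unitInterval

variable {V : Type*} [DecidableEq V] {K : PreAbstractSimplicialComplex V} {a : V}

open Classical in
/-- The map to the circle that winds the simplex spanned by `F` around the circle by means of the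
coordinate at `r` and sends everything else to the base point. It is of use if `F` is an edge with
endpoint `r`. -/
noncomputable def edgeToCircle (F : Finset V) (r : V) (x : V → ℝ) : AddCircle (1 : ℝ) :=
  if x ∈ faceSimplex F then ((x r : ℝ) : AddCircle (1 : ℝ)) else 0

theorem edgeToCircle_of_cellDepth_eq_zero {p r : V} {x : V → ℝ}
    (h : cellDepth {p, r} x = 0) : edgeToCircle {p, r} r x = 0 := by
  unfold edgeToCircle
  split_ifs with hx
  · obtain ⟨v, hv, hv0⟩ := exists_cellDepth_eq (Finset.insert_nonempty p {r}) x
    rw [h, eq_comm, mul_eq_zero] at hv0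
    have hxv := hv0.resolve_left (Nat.cast_ne_zero.2 (Finset.insert_nonempty p {r}).card_pos.ne')
    by_cases hpr : p = r
    · subst hpr
      have := hx.2.2
      rw [Finset.pair_eq_singleton, Finset.sum_singleton] at this
      rw [this, AddCircle.coe_period]
    · have hsum := hx.2.2
      rw [Finset.sum_pair hpr] at hsum
      rcases Finset.mem_insert.1 hv with rfl | hv
      · rw [hxv, zero_add] at hsum
        rw [hsum, AddCircle.coe_period]
      · rw [Finset.mem_singleton.1 hv] at hxv
        rw [hxv, AddCircle.coe_zero]
  · rfl

theorem IsAlmostCone.continuous_edgeToCircle (hK : IsAlmostCone K a) {p r : V}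
    (hF : {p, r} ∈ coneCells K a) :
    Continuous fun x : mainPart K a => edgeToCircle {p, r} r x := by
  let s : Bool → Set (mainPart K a) := fun b =>
    if b then {x | x.1 ∈ faceSimplex {p, r}} else {x | cellDepth {p, r} x.1 = 0}
  refine (locallyFinite_of_finite s).continuous ?_ ?_ ?_
  · refine Set.eq_univ_of_forall fun x => Set.mem_iUnion.2 ?_
    rcases (cellDepth_nonneg_of_mem {p, r} x.2.1).eq_or_lt with h | h
    · exact ⟨false, h.symm⟩
    · exact ⟨true, hK.mem_faceSimplex_of_cellDepth_pos hF x.2.1 h⟩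
  · rintro (_ | _)
    · exact isClosed_eq ((continuous_cellDepth _).comp continuous_subtype_val) continuous_const
    · exact (isClosed_faceSimplex _).preimage continuous_subtype_val
  · rintro (_ | _)
    · exact (continuousOn_const (c := (0 : AddCircle (1 : ℝ)))).congr fun x hx =>
        edgeToCircle_of_cellDepth_eq_zero hx
    · refine ContinuousOn.congr (f := fun x : mainPart K a =>
        ((x.1 r : ℝ) : AddCircle (1 : ℝ))) ?_ fun x hx => if_pos hx
      exact (continuous_quotient_mk'.comp
        ((continuous_apply r).comp continuous_subtype_val)).continuousOn

/-- An edge outside the cone gives a loop which is not nullhomotopic: the edge and a path in the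
cone with the same endpoints have images in the circle whose lifts to the line have different
endpoints. -/
theorem IsAlmostCone.not_isSimplyConnected_mainPart (hK : IsAlmostCone K a) {F : Finset V}
    (hF : F ∈ coneCells K a) (hcard : F.card = 2) : ¬ IsSimplyConnected (mainPart K a) := by
  intro hsc
  obtain ⟨p, r, hpr, rfl⟩ := Finset.card_eq_two.1 hcard
  have hp := hK.single_mem_coneOf_of_mem hF hcard.ge (Finset.mem_insert_self p {r})
  have hr := hK.single_mem_coneOf_of_mem hF hcard.ge
    (Finset.mem_insert_of_mem (Finset.mem_singleton_self r))
  have hpF : Pi.single p 1 ∈ faceSimplex {p, r} :=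
    single_mem_faceSimplex (Finset.mem_insert_self p {r})
  have hrF : Pi.single r 1 ∈ faceSimplex {p, r} :=
    single_mem_faceSimplex (Finset.mem_insert_of_mem (Finset.mem_singleton_self r))
  let P : mainPart K a := ⟨_, coneOf_subset_mainPart hp⟩
  let R : mainPart K a := ⟨_, coneOf_subset_mainPart hr⟩
  obtain ⟨γ, hγ⟩ := (hK.starConvex_coneOf.isPathConnected
    hK.single_mem_coneOf).joinedIn _ hp _ hr
  have hseg : ∀ t : I, (1 - (t : ℝ)) • (Pi.single p 1 : V → ℝ) + (t : ℝ) • Pi.single r 1 ∈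
      faceSimplex {p, r} := fun t =>
    convex_faceSimplex _ hpF hrF (by linarith [t.2.2]) t.2.1 (by ring)
  let γ₀ : Path P R := ⟨⟨fun t => ⟨γ t, coneOf_subset_mainPart (hγ t)⟩, by fun_prop⟩,
    Subtype.ext γ.source, Subtype.ext γ.target⟩
  let γ₁ : Path P R := ⟨⟨fun t => ⟨(1 - (t : ℝ)) • Pi.single p 1 + (t : ℝ) • Pi.single r 1,
    hK.faceSimplex_subset_mainPart hF (by omega) (hseg t)⟩, by fun_prop⟩,
    Subtype.ext (by simp [P]), Subtype.ext (by simp [R])⟩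
  have : SimplyConnectedSpace (mainPart K a) := hsc
  let φ : C(mainPart K a, AddCircle (1 : ℝ)) := ⟨_, hK.continuous_edgeToCircle hF⟩
  have hhom := (SimplyConnectedSpace.paths_homotopic γ₀ γ₁).map φ
  have hφ₀ : ∀ t, φ (γ₀ t) = ((0 : ℝ) : AddCircle (1 : ℝ)) := fun t =>
    (edgeToCircle_of_cellDepth_eq_zero ((hγ t).2 _ hF)).trans (AddCircle.coe_zero _).symm
  have hcoord : ∀ t : I,
      ((1 - (t : ℝ)) • Pi.single p 1 + (t : ℝ) • Pi.single r 1 : V → ℝ) r = t := fun t => by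
    simp [hpr.symm]
  have hφ₁ : ∀ t : I, φ (γ₁ t) = ((t : ℝ) : AddCircle (1 : ℝ)) := fun t =>
    (if_pos (hseg t)).trans (congrArg _ (hcoord t))
  have cov := AddCircle.isCoveringMap_coe (1 : ℝ)
  have hφ₁_zero : φ (γ₁ 0) = ((0 : ℝ) : AddCircle (1 : ℝ)) :=
    (hφ₁ 0).trans (by rw [Set.Icc.coe_zero])
  have lift₀ : ContinuousMap.const I (0 : ℝ) =
      cov.liftPath (γ₀.map φ.continuous).toContinuousMap 0 (hφ₀ 0) :=
    (cov.eq_liftPath_iff' _).2 ⟨funext fun t => (hφ₀ t).symm, rfl⟩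
  have lift₁ : (⟨Subtype.val, continuous_subtype_val⟩ : C(I, ℝ)) =
      cov.liftPath (γ₁.map φ.continuous).toContinuousMap 0 hφ₁_zero :=
    (cov.eq_liftPath_iff' _).2 ⟨funext fun t => (hφ₁ t).symm, rfl⟩
  have hlift := cov.liftPath_apply_one_eq_of_homotopicRel hhom 0 (hφ₀ 0) hφ₁_zero
  rw [← lift₀, ← lift₁] at hlift
  exact zero_ne_one (hlift : (0 : ℝ) = 1)

theorem IsAlmostCone.hasNonSimplyConnectedComponent_iff_exists_card_eq_two
    (hK : IsAlmostCone K a) (hfin : K.faces.Finite) :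
    HasNonSimplyConnectedComponent (geometricRealization K) ↔
      ∃ F ∈ coneCells K a, F.card = 2 := by
  rw [hK.hasNonSimplyConnectedComponent_iff hfin]
  constructor
  · intro h
    by_contra! h2
    exact h (hK.isSimplyConnected_mainPart hfin h2)
  · rintro ⟨F, hF, hcard⟩
    exact hK.not_isSimplyConnected_mainPart hF hcard

end EdgeLoop

/-! ### The prime complexes -/

section PrimeComplex

theorem mem_primeComplex_iff {q : ℕ} {F : Finset {p : ℕ // p.Prime}} :
    F ∈ (primeComplex q).faces ↔ F.Nonempty ∧ ∑ v ∈ F, (v : ℕ) < q := by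
  change (F.Nonempty ∧ ∑ v ∈ F, ((v : ℕ) : ℝ) < q) ↔ _
  rw [← Nat.cast_sum, Nat.cast_lt]

/-- The even prime. -/
def primeTwo : {p : ℕ // p.Prime} := ⟨2, Nat.prime_two⟩

theorem odd_of_ne_primeTwo {v : {p : ℕ // p.Prime}} (h : v ≠ primeTwo) : Odd (v : ℕ) :=
  v.2.odd_of_ne_two fun h2 => h (Subtype.ext h2)

/-- The set of natural numbers underlying a set of primes. -/
def primesToNat (F : Finset {p : ℕ // p.Prime}) : Finset ℕ :=
  F.map (Function.Embedding.subtype _)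

theorem primesToNat_injective : Function.Injective primesToNat :=
  Finset.map_injective _

theorem exists_primesToNat_eq {q j : ℕ} {S : Finset ℕ}
    (hS : S ∈ oddPrimeSums (q - 1) (j + 1) ∪ oddPrimeSums (q - 2) (j + 1)) :
    ∃ F, primesToNat F = S :=
  ⟨S.subtype Nat.Prime, Finset.subtype_map_of_mem fun p hp => by
    rcases hS with h | h
    · exact (h.2.1 p hp).1
    · exact (h.2.1 p hp).1⟩

variable [DecidableEq {p : ℕ // p.Prime}] {q : ℕ}

/-- Replacing an odd prime by `2` decreases the sum. -/
theorem isAlmostCone_primeComplex (hq : 3 ≤ q) : IsAlmostCone (primeComplex q) primeTwo := by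
  refine ⟨mem_primeComplex_iff.2 ⟨Finset.singleton_nonempty _, ?_⟩, fun F hF hins v hv => ?_⟩
  · rw [Finset.sum_singleton]
    exact hq
  · have h2 : primeTwo ∉ F := fun h => hins (by rwa [Finset.insert_eq_self.2 h])
    have hv2 : v ≠ primeTwo := fun h => h2 (h ▸ hv)
    have hlt := (mem_primeComplex_iff.1 hF).2
    rw [← Finset.add_sum_erase F _ hv] at hlt
    have hv3 : 2 < (v : ℕ) := lt_of_le_of_ne v.2.two_le fun h => hv2 (Subtype.ext h.symm)
    refine mem_primeComplex_iff.2 ⟨Finset.insert_nonempty _ _, ?_⟩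
    rw [Finset.sum_insert fun h => h2 (Finset.mem_of_mem_erase h)]
    change 2 + _ < q
    omega

theorem mem_coneCells_primeComplex_iff {F : Finset {p : ℕ // p.Prime}} :
    F ∈ coneCells (primeComplex q) primeTwo ↔
      F.Nonempty ∧ primeTwo ∉ F ∧ ∑ v ∈ F, (v : ℕ) < q ∧ q ≤ ∑ v ∈ F, (v : ℕ) + 2 := by
  constructor
  · intro hF
    have h2 := apex_notMem_of_mem_coneCells hF
    have h := mem_primeComplex_iff.1 hF.1
    refine ⟨h.1, h2, h.2, ?_⟩
    by_contra! hlt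
    refine hF.2 (mem_primeComplex_iff.2 ⟨Finset.insert_nonempty _ _, ?_⟩)
    rw [Finset.sum_insert h2, add_comm]
    exact hlt
  · rintro ⟨hne, h2, hlt, hle⟩
    refine ⟨mem_primeComplex_iff.2 ⟨hne, hlt⟩, fun h => ?_⟩
    have h' := (mem_primeComplex_iff.1 h).2
    rw [Finset.sum_insert h2, add_comm] at h'
    exact absurd hle (not_le.2 h')

theorem primesToNat_mem_oddPrimeSums_iff (hq : 4 ≤ q) {F : Finset {p : ℕ // p.Prime}} {j : ℕ} :
    primesToNat F ∈ oddPrimeSums (q - 1) (j + 1) ∪ oddPrimeSums (q - 2) (j + 1) ↔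
      F ∈ coneCells (primeComplex q) primeTwo ∧ F.card = j + 1 := by
  have hsum : ∑ p ∈ primesToNat F, p = ∑ v ∈ F, (v : ℕ) := by
    rw [primesToNat, Finset.sum_map]
    rfl
  have hcard : (primesToNat F).card = F.card := Finset.card_map _
  have hodd : (∀ p ∈ primesToNat F, p.Prime ∧ Odd p) ↔ primeTwo ∉ F := by
    constructor
    · intro h h2
      have h2' := (h 2 (Finset.mem_map.2 ⟨primeTwo, h2, rfl⟩)).2
      exact absurd h2' (by decide)
    · intro h p hp
      obtain ⟨v, hv, rfl⟩ := Finset.mem_map.1 hp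
      exact ⟨v.2, odd_of_ne_primeTwo fun hv2 => h (hv2 ▸ hv)⟩
  rw [mem_coneCells_primeComplex_iff, ← Finset.card_pos]
  change ((primesToNat F).card = j + 1 ∧ _ ∧ _) ∨ ((primesToNat F).card = j + 1 ∧ _ ∧ _) ↔ _
  rw [hsum, hcard, hodd]
  constructor
  · rintro (⟨h1, h2, h3⟩ | ⟨h1, h2, h3⟩)
    · exact ⟨⟨by omega, h2, by omega, by omega⟩, h1⟩
    · exact ⟨⟨by omega, h2, by omega, by omega⟩, h1⟩
  · rintro ⟨⟨-, h2, h3, h4⟩, h1⟩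
    rcases (by omega : ∑ v ∈ F, (v : ℕ) = q - 1 ∨ ∑ v ∈ F, (v : ℕ) = q - 2) with h | h
    · exact Or.inl ⟨h1, h2, h⟩
    · exact Or.inr ⟨h1, h2, h⟩

/-- The faces of `Prime(q)` outside the cone with apex `2` correspond to the ways of writing `q - 1`
or `q - 2` as a sum of distinct odd primes. -/
theorem exists_equiv_coneCells (hq : 4 ≤ q) :
    ∃ e : (Σ j : ℕ, ↥(oddPrimeSums (q - 1) (j + 1) ∪ oddPrimeSums (q - 2) (j + 1))) ≃
      coneCells (primeComplex q) primeTwo, ∀ i, (e i).1.card = i.1 + 1 := by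
  have hcard : ∀ F : coneCells (primeComplex q) primeTwo, F.1.card = F.1.card - 1 + 1 := fun F =>
    (Nat.sub_add_cancel (mem_coneCells_primeComplex_iff.1 F.2).1.card_pos).symm
  let g : coneCells (primeComplex q) primeTwo →
      (Σ j : ℕ, ↥(oddPrimeSums (q - 1) (j + 1) ∪ oddPrimeSums (q - 2) (j + 1))) := fun F =>
    ⟨F.1.card - 1, primesToNat F.1, (primesToNat_mem_oddPrimeSums_iff hq).2 ⟨F.2, hcard F⟩⟩
  have hg : Function.Bijective g := by
    constructor
    · intro F G h
      exact Subtype.ext (primesToNat_injective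
        (congrArg (fun s : (Σ j : ℕ,
          ↥(oddPrimeSums (q - 1) (j + 1) ∪ oddPrimeSums (q - 2) (j + 1))) =>
          s.2.1) h))
    · rintro ⟨j, S, hS⟩
      obtain ⟨F, rfl⟩ := exists_primesToNat_eq hS
      obtain ⟨hF, hj⟩ := (primesToNat_mem_oddPrimeSums_iff hq).1 hS
      obtain rfl : j = F.card - 1 := by omega
      exact ⟨⟨F, hF⟩, rfl⟩
  refine ⟨(Equiv.ofBijective g hg).symm, fun i => ?_⟩
  obtain ⟨F, rfl⟩ := hg.2 i
  rw [Equiv.ofBijective_symm_apply_apply]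
  exact hcard F

theorem ncard_oddPrimeSums (hq : 4 ≤ q) (j : ℕ) :
    (oddPrimeSums (q - 1) (j + 1) ∪ oddPrimeSums (q - 2) (j + 1)).ncard =
      {F | F ∈ coneCells (primeComplex q) primeTwo ∧ F.card = j + 1}.ncard := by
  rw [← Set.ncard_image_of_injective _ primesToNat_injective]
  congr 1
  ext S
  constructor
  · intro hS
    obtain ⟨F, rfl⟩ := exists_primesToNat_eq hS
    exact ⟨F, (primesToNat_mem_oddPrimeSums_iff hq).1 hS, rfl⟩
  · rintro ⟨F, hF, rfl⟩
    exact (primesToNat_mem_oddPrimeSums_iff hq).2 hF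

theorem exists_coneCells_card_one_iff (hq : 4 ≤ q) (heven : Even q) :
    (∃ F ∈ coneCells (primeComplex q) primeTwo, F.card = 1) ↔ (q - 1).Prime := by
  obtain ⟨k, hk⟩ := heven
  constructor
  · rintro ⟨F, hF, hcard⟩
    obtain ⟨p, rfl⟩ := Finset.card_eq_one.1 hcard
    obtain ⟨-, h2, hlt, hle⟩ := mem_coneCells_primeComplex_iff.1 hF
    rw [Finset.sum_singleton] at hlt hle
    obtain ⟨m, hm⟩ := odd_of_ne_primeTwo fun h => h2 (Finset.mem_singleton.2 h.symm)
    rw [show q - 1 = (p : ℕ) by omega]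
    exact p.2
  · intro hp
    refine ⟨{⟨q - 1, hp⟩}, mem_coneCells_primeComplex_iff.2
      ⟨Finset.singleton_nonempty _, fun h => ?_, ?_, ?_⟩, Finset.card_singleton _⟩
    · have := congrArg Subtype.val (Finset.mem_singleton.1 h)
      change 2 = q - 1 at this
      omega
    · rw [Finset.sum_singleton]
      change q - 1 < q
      omega
    · rw [Finset.sum_singleton]
      change q ≤ q - 1 + 2
      omega

theorem exists_coneCells_card_two_iff (hq : 4 ≤ q) (heven : Even q) :
    (∃ F ∈ coneCells (primeComplex q) primeTwo, F.card = 2) ↔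
      ∃ p r : ℕ, p.Prime ∧ r.Prime ∧ Odd p ∧ Odd r ∧ p ≠ r ∧ q - 2 = p + r := by
  obtain ⟨k, hk⟩ := heven
  constructor
  · rintro ⟨F, hF, hcard⟩
    obtain ⟨p, r, hpr, rfl⟩ := Finset.card_eq_two.1 hcard
    obtain ⟨-, h2, hlt, hle⟩ := mem_coneCells_primeComplex_iff.1 hF
    rw [Finset.sum_pair hpr] at hlt hle
    simp only [Finset.mem_insert, Finset.mem_singleton, not_or] at h2
    have hp := odd_of_ne_primeTwo (Ne.symm h2.1)
    have hr := odd_of_ne_primeTwo (Ne.symm h2.2)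
    refine ⟨p, r, p.2, r.2, hp, hr, fun h => hpr (Subtype.ext h), ?_⟩
    obtain ⟨m, hm⟩ := hp
    obtain ⟨l, hl⟩ := hr
    omega
  · rintro ⟨p, r, hp, hr, hpo, hro, hpr, hsum⟩
    have hne : (⟨p, hp⟩ : {p : ℕ // p.Prime}) ≠ ⟨r, hr⟩ := fun h => hpr (congrArg Subtype.val h)
    refine ⟨{⟨p, hp⟩, ⟨r, hr⟩}, mem_coneCells_primeComplex_iff.2
      ⟨Finset.insert_nonempty _ _, fun h => ?_, ?_, ?_⟩, Finset.card_pair hne⟩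
    · rcases Finset.mem_insert.1 h with h | h
      · obtain rfl : 2 = p := congrArg Subtype.val h
        exact absurd hpo (by decide)
      · obtain rfl : 2 = r := congrArg Subtype.val (Finset.mem_singleton.1 h)
        exact absurd hro (by decide)
    · rw [Finset.sum_pair hne]
      change p + r < q
      omega
    · rw [Finset.sum_pair hne]
      change q ≤ p + r + 2
      omega

end PrimeComplex

theorem not_connectedSpace_primeComplex_iff {q : ℕ} (hq : 4 ≤ q) (heven : Even q) :
    ¬ ConnectedSpace (geometricRealization (primeComplex q)) ↔ (q - 1).Prime := by
  rw [(isAlmostCone_primeComplex (by omega)).connectedSpace_iff,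
    ← exists_coneCells_card_one_iff hq heven]
  push Not
  rfl

theorem hasNonSimplyConnectedComponent_primeComplex_iff {q : ℕ} (hq : 4 ≤ q) (heven : Even q) :
    HasNonSimplyConnectedComponent (geometricRealization (primeComplex q)) ↔
      ∃ p r : ℕ, p.Prime ∧ r.Prime ∧ Odd p ∧ Odd r ∧ p ≠ r ∧ q - 2 = p + r := by
  rw [(isAlmostCone_primeComplex
    (by omega)).hasNonSimplyConnectedComponent_iff_exists_card_eq_two (primeComplex_faces_finite q),
    exists_coneCells_card_two_iff hq heven]

theorem twinPrimeConjecture_iff : TwinPrimeConjecture ↔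
    {q : ℕ | Even q ∧ 4 ≤ q ∧
      ¬ ConnectedSpace (geometricRealization (primeComplex q)) ∧
      ¬ ConnectedSpace (geometricRealization (primeComplex (q + 2)))}.Infinite := by
  have heq : {q : ℕ | Even q ∧ 4 ≤ q ∧
      ¬ ConnectedSpace (geometricRealization (primeComplex q)) ∧
      ¬ ConnectedSpace (geometricRealization (primeComplex (q + 2)))} =
      (· + 1) '' {p : ℕ | p.Prime ∧ (p + 2).Prime} := by
    ext q
    constructor
    · rintro ⟨heven, hq, h1, h2⟩
      rw [not_connectedSpace_primeComplex_iff hq heven] at h1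
      rw [not_connectedSpace_primeComplex_iff (by omega) (heven.add even_two)] at h2
      exact ⟨q - 1, ⟨h1, by rwa [show q - 1 + 2 = q + 2 - 1 by omega]⟩,
        by change q - 1 + 1 = q; omega⟩
    · rintro ⟨p, ⟨hp, hp2⟩, rfl⟩
      have hne : p ≠ 2 := by
        rintro rfl
        exact absurd hp2 (by decide)
      have hodd := hp.odd_of_ne_two hne
      have hge : 4 ≤ p + 1 := by
        have := hp.two_le
        omega
      refine ⟨hodd.add_one, hge, ?_, ?_⟩
      · exact (not_connectedSpace_primeComplex_iff hge hodd.add_one).2 hp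
      · exact (not_connectedSpace_primeComplex_iff (by omega) (hodd.add_one.add even_two)).2 hp2
  rw [heq, Set.infinite_image_iff (add_left_injective 1).injOn]
  rfl

theorem goldbachConjecture_iff : GoldbachConjecture ↔
    ∀ q : ℕ, Even q → 6 ≤ q → (∀ p : ℕ, p.Prime → q - 2 ≠ 2 * p) →
      HasNonSimplyConnectedComponent (geometricRealization (primeComplex q)) := by
  constructor
  · intro h q heven hq hnot
    rw [hasNonSimplyConnectedComponent_primeComplex_iff (by omega) heven]
    obtain ⟨k, hk⟩ := heven
    have heven2 : Even (q - 2) := ⟨k - 1, by omega⟩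
    obtain ⟨p, r, hp, hr, hsum⟩ := h (q - 2) (by omega) heven2
    have hpr : p ≠ r := by
      rintro rfl
      exact hnot p hp (by omega)
    have hodd : ∀ p r : ℕ, p.Prime → r.Prime → p ≠ r → q - 2 = p + r → Odd p := by
      intro p r hp hr hpr hsum
      refine hp.odd_of_ne_two ?_
      -- two even summands would both be `2`
      rintro rfl
      refine hpr (hr.even_iff.1 ?_).symm
      rw [Nat.even_iff] at heven2 ⊢
      omega
    exact ⟨p, r, hp, hr, hodd p r hp hr hpr hsum, hodd r p hr hp hpr.symm (by omega), hpr, hsum⟩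
  · intro h n hn heven
    by_cases hp : ∃ p : ℕ, p.Prime ∧ n = 2 * p
    · obtain ⟨p, hp, hnp⟩ := hp
      exact ⟨p, p, hp, hp, by omega⟩
    · push Not at hp
      have := h (n + 2) (heven.add even_two) (by omega) hp
      rw [hasNonSimplyConnectedComponent_primeComplex_iff (by omega) (heven.add even_two)] at this
      obtain ⟨p, r, hp, hr, -, -, -, hsum⟩ := this
      exact ⟨p, r, hp, hr, hsum⟩

theorem mainTheorem2 :
    (∀ q : ℕ, Even q → 4 ≤ q →
      -- the odd and the even integer in `[q - 2, q)`
      {n : ℤ | n ∈ Set.Ico ((q : ℤ) - 2) q ∧ Odd n} = {(q : ℤ) - 1} ∧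
      {n : ℤ | n ∈ Set.Ico ((q : ℤ) - 2) q ∧ Even n} = {(q : ℤ) - 2} ∧
      -- the homotopy type: finitely many spheres, one `j`-sphere for every way of writing
      -- `q - 1` or `q - 2` as a sum of `j + 1` distinct odd primes
      Finite (Σ j : ℕ, ↥(oddPrimeSums (q - 1) (j + 1) ∪ oddPrimeSums (q - 2) (j + 1))) ∧
      Nonempty (geometricRealization (primeComplex q) ≃ₕ
        Bouquet fun s : (Σ j : ℕ,
          ↥(oddPrimeSums (q - 1) (j + 1) ∪ oddPrimeSums (q - 2) (j + 1))) => s.1) ∧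
      -- the reduced rational homology
      (∀ j : ℕ, Module.rank ℚ (ReducedHomology (primeComplex q) j) =
        ((oddPrimeSums (q - 1) (j + 1) ∪ oddPrimeSums (q - 2) (j + 1)).ncard : Cardinal)) ∧
      -- connectedness and simple connectedness
      (6 ≤ q → (¬ ConnectedSpace (geometricRealization (primeComplex q)) ↔ (q - 1).Prime)) ∧
      (6 ≤ q → (HasNonSimplyConnectedComponent (geometricRealization (primeComplex q)) ↔
        ∃ p r : ℕ, p.Prime ∧ r.Prime ∧ Odd p ∧ Odd r ∧ p ≠ r ∧ q - 2 = p + r))) ∧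
    (TwinPrimeConjecture ↔
      {q : ℕ | Even q ∧ 4 ≤ q ∧
        ¬ ConnectedSpace (geometricRealization (primeComplex q)) ∧
        ¬ ConnectedSpace (geometricRealization (primeComplex (q + 2)))}.Infinite) ∧
    (GoldbachConjecture ↔
      ∀ q : ℕ, Even q → 6 ≤ q → (∀ p : ℕ, p.Prime → q - 2 ≠ 2 * p) →
        HasNonSimplyConnectedComponent (geometricRealization (primeComplex q))) := by
  refine ⟨fun q heven hq => ?_, twinPrimeConjecture_iff, goldbachConjecture_iff⟩
  have hK := isAlmostCone_primeComplex (q := q) (by omega)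
  have hfin := primeComplex_faces_finite q
  obtain ⟨e, he⟩ := exists_equiv_coneCells hq
  have hcells : Finite (coneCells (primeComplex q) primeTwo) :=
    (hfin.subset fun F hF => hF.1).to_subtype
  refine ⟨?_, ?_, Finite.of_equiv _ e.symm, nonempty_homotopyEquiv_bouquet hK hfin e he,
    fun j => ?_, fun _ => not_connectedSpace_primeComplex_iff hq heven,
    fun _ => hasNonSimplyConnectedComponent_primeComplex_iff hq heven⟩
  · obtain ⟨k, hk⟩ := heven
    ext n
    simp only [Set.mem_ofPred_eq, Set.mem_Ico, Set.mem_singleton_iff, Int.odd_iff]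
    omega
  · obtain ⟨k, hk⟩ := heven
    ext n
    simp only [Set.mem_ofPred_eq, Set.mem_Ico, Set.mem_singleton_iff, Int.even_iff]
    omega
  · rw [ncard_oddPrimeSums hq]
    exact rank_reducedHomology_of_isAlmostCone (fun v => v.2.two_le) hK hfin j
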